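/- **The word GREM.** Let $n\ge 1$, let $I=\{\varsigma_1,\dots,\varsigma_n\}$ be a set of $n$ symbols and let $S$ be a finite set of non-empty words in these symbols (a symbol may be repeated in a word). For $N\ge n$ let $k(1,N),\dots,k(n,N)\ge 1$ be integers with $\sum_{i=1}^n k(i,N)=N$ and, for every $i$, $k(i,N)/N\to p_i>0$ as $N\to\infty$. Write a configuration $\sigma\in\{+1,-1\}^N$ as $\sigma=(\sigma^1,\dots,\sigma^n)$ with consecutive blocks $\sigma^i\in\{+1,-1\}^{k(i,N)}$, and for a word $s=\varsigma_{i_1}\cdots\varsigma_{i_l}\in S$ put $\sigma(s)=(\sigma^{i_1},\dots,\sigma^{i_l})$. For each $s\in S$ let $\lambda^s$ be a probability measure on $\mathbb R$ such that $0$ is an interior point of $\{\rho\in\mathbb R:\Lambda_s(\rho)<\infty\}$, where $\Lambda_s(\rho)=\log\int e^{\rho u}\,\lambda^s(du)$, and let $\lambda^s_N$ be the law of $\frac1N(X_1+\dots+X_N)$ for $X_1,\dots,X_N$ i.i.d. with law $\lambda^s$. On one probability space let, for each $N\ge n$, real random variables $\xi(s,\sigma(s))$ be given, one for each $s\in S$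 and each possible value of $\sigma(s)$; for each fixed $N$ they are independent and $\xi(s,\sigma(s))$ has law $\lambda_N^s$ (nothing is assumed on their joint law for different $N$). Let $f:\mathbb R^S\to\mathbb R$ be continuous, $\beta>0$, $h\ge 0$, and $$H_N(\sigma,h)=N f\big((\xi(s,\sigma(s)))_{s\in S}\big)+h\sum_{j=1}^N\sigma_j,\qquad Z_N(\beta,h)=\sum_{\sigma\in\{+1,-1\}^N}e^{-\beta H_N(\sigma,h)}.$$ **Rate functions.** For $s\in S$ put $\mathcal I_s(x)=\sup_{\rho\in\mathbb R}\{\rho x-\Lambda_s(\rho)\}$. Put $\mathcal I_0(y)=\frac{1+y}2\log(1+y)+\frac{1-y}2\log(1-y)$ for $|y|\le 1$ (with $0\log 0=0$) and $\mathcal I_0(y)=\infty$ for $|y|>1$. Let $\mathcal D_{\mathcal J}$ be the set of all $(x_S,y_I)\in\mathbb R^S\times\mathbb R^n$ such that for every $A\subseteq\{1,\dots,n\}$ $$\sum_{s\in S_A}\mathcal I_s(x_s)+\sum_{i\in A}p_i\,\mathcal I_0\!\left(\frac{y_i}{p_i}\right)\le\sum_{i\in A}p_i\log 2,$$ where $S_A$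 is the set of the words $s\in S$ all of whose symbols are among the $\varsigma_i$, $i\in A$. Let $\mathcal J(x_S,y_I)=\sum_{s\in S}\mathcal I_s(x_s)+\sum_{i=1}^n p_i\,\mathcal I_0(y_i/p_i)$ for $(x_S,y_I)\in\mathcal D_{\mathcal J}$, and $\mathcal J=\infty$ elsewhere. **Theorem.** The infimum below is finite, and almost surely the limiting free energy exists and $$\lim_{N\to\infty}\frac1N\log Z_N(\beta,h)=\log 2-\inf_{(x_S,y_I)\in\mathcal D_{\mathcal J}}\Big\{\beta f(x_S)+\beta h\sum_{i=1}^n y_i+\mathcal J(x_S,y_I)\Big\}.$$ (With $f(x_S)=\sum_{s\in S}a_sx_s$ this covers the REM, for $S=\{\varsigma_1\cdots\varsigma_n\}$; the GREM, for $S=\{\varsigma_1,\varsigma_1\varsigma_2,\dots,\varsigma_1\cdots\varsigma_n\}$; and the Bolthausen–Kistler GREM, for $S$ in bijection with the non-empty subsets of $I$; with a field, $h>0$, or without, $h=0$.) -/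

import Mathlib

open MeasureTheory ProbabilityTheory Filter Topology

noncomputable section

namespace WordGREM

/-- The configuration space `{+1, -1}^N`, with `N = k 0 + ... + k (n - 1)`, written as the product
of its `n` blocks `{+1, -1}^(k i)`. The spins are the units of `ℤ`. -/
abbrev Config {n : ℕ} (k : Fin n → ℕ) : Type := (i : Fin n) → Fin (k i) → ℤˣ

/-- The possible values of `σ(s)`, for a word `s`. Since `σ(s)` lists the blocks of `σ` along the
word `s`, it is the same datum as the family of the blocks `σ^i`, where `i` runs over the (distinct)
symbols of `s`. There are `2 ^ k(s, N)` such values. -/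
abbrev WordConfig {n : ℕ} (k : Fin n → ℕ) (s : List (Fin n)) : Type :=
  (i : {i : Fin n // i ∈ s}) → Fin (k i) → ℤˣ

/-- `σ(s)`. -/
def Config.word {n : ℕ} {k : Fin n → ℕ} (σ : Config k) (s : List (Fin n)) : WordConfig k s :=
  fun i => σ i

/-- The sum of the spins in the block `i`. -/
def Config.blockSum {n : ℕ} {k : Fin n → ℕ} (σ : Config k) (i : Fin n) : ℝ :=
  ∑ j, (((σ i j : ℤˣ) : ℤ) : ℝ)

/-- The law of `(X_1 + ... + X_N) / N`, where `X_1, ..., X_N` are i.i.d. with law `lam`. -/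
def sampleMeanLaw (lam : Measure ℝ) (N : ℕ) : Measure ℝ :=
  (Measure.pi (fun _ : Fin N => lam)).map (fun x => (∑ j, x j) / (N : ℝ))

/-- The Hamiltonian `N f(ξ(σ)) + h ∑ σ_i`, for a realisation `ξ` of the driving variables. -/
def hamiltonian {n : ℕ} {k : Fin n → ℕ} (S : Finset (List (Fin n))) (f : (S → ℝ) → ℝ)
    (h : ℝ) (N : ℕ) (ξ : (s : S) → WordConfig k s → ℝ) (σ : Config k) : ℝ :=
  (N : ℝ) * f (fun s => ξ s (σ.word s)) + h * ∑ i, σ.blockSum i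

/-- The partition function `∑_σ exp (-β H_N(σ, h))`. -/
def partitionFunction {n : ℕ} {k : Fin n → ℕ} (S : Finset (List (Fin n))) (f : (S → ℝ) → ℝ)
    (β h : ℝ) (N : ℕ) (ξ : (s : S) → WordConfig k s → ℝ) : ℝ :=
  ∑ σ : Config k, Real.exp (-β * hamiltonian S f h N ξ σ)

/-- The Fenchel-Legendre transform `sup_ρ (ρ x - Λ(ρ))` of the log-Laplace transform
`Λ(ρ) = log ∫ exp (ρ u) d lam(u)`; the values `ρ` with `Λ(ρ) = ∞` do not contribute. -/
def cramerRate (lam : Measure ℝ) (x : ℝ) : EReal :=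
  ⨆ ρ ∈ integrableExpSet id lam, ((ρ * x - cgf id lam ρ : ℝ) : EReal)

/-- The rate function of the sample means of symmetric `±1` variables. -/
def spinRate (y : ℝ) : EReal :=
  if |y| ≤ 1 then
    (((1 + y) / 2 * Real.log (1 + y) + (1 - y) / 2 * Real.log (1 - y) : ℝ) : EReal)
  else ⊤

/-- The sum of the rates of the words of `S` all of whose symbols are in `A` and of the blocks
that belong to `A`. -/
def rateSum {n : ℕ} (S : Finset (List (Fin n))) (lam : S → Measure ℝ) (p : Fin n → ℝ)
    (A : Finset (Fin n)) (z : (S → ℝ) × (Fin n → ℝ)) : EReal :=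
  (∑ t ∈ Finset.univ.filter (fun t : S => ∀ i ∈ t.1, i ∈ A), cramerRate (lam t) (z.1 t)) +
    ∑ i ∈ A, (p i : EReal) * spinRate (z.2 i / p i)

/-- The set `D_J`. -/
def rateDomain {n : ℕ} (S : Finset (List (Fin n))) (lam : S → Measure ℝ) (p : Fin n → ℝ) :
    Set ((S → ℝ) × (Fin n → ℝ)) :=
  {z | ∀ A : Finset (Fin n), rateSum S lam p A z ≤ ((∑ i ∈ A, p i * Real.log 2 : ℝ) : EReal)}

open Classical in
/-- The rate function `J`. -/
def rate {n : ℕ} (S : Finset (List (Fin n))) (lam : S → Measure ℝ) (p : Fin n → ℝ)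
    (z : (S → ℝ) × (Fin n → ℝ)) : EReal :=
  if z ∈ rateDomain S lam p then
    (∑ s : S, cramerRate (lam s) (z.1 s)) + ∑ i, (p i : EReal) * spinRate (z.2 i / p i)
  else ⊤

end WordGREM

end

/-! Sort the configurations by their empirical vector: the driving variables they see and their
block magnetisations divided by `N`. The energy is `N` times a continuous function of this vector,
so the theorem reduces, by Laplace's method, to a count: almost surely about `exp (N (log 2 - J z))`
configurations have empirical vector near `z` when `z` lies in `rateDomain`, and eventually none do
otherwise.

Upper bound. For a set `A` of blocks, Chernoff's bound and the counting of spins with prescribed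
magnetisation show that the expected number of partial configurations on `A` that look like `z` is
at most `exp (N (∑ i ∈ A, p i log 2 - rateSum A z))`, up to a small error in the exponent
(`eventually_partial_mean_le`). If this exponent is negative for some `A`, no partial configuration
exists eventually, hence no full one. If `z` is in the domain, Markov's inequality with all the
blocks bounds the count. Exponential tightness and a finite cover of a compact set then bound the
partition function.

Lower bound. Two configurations that agree exactly on the blocks of `A` share precisely the
variables of the words written in `A`. Relative to the squared mean, such pairs contribute to the
second moment at most the inverse of the expected number of partial configurations on `A`. So the
count concentrates as soon as the constraints for all non-empty `A` are strict
(`prob_card_goodConfigs_lt`). Strictness is gained by moving `z` a little towards the typical point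
(the means of the `lam s`, zero magnetisation): the rates vanish there and, by convexity, shrink at
least by the factor `t` along the segment, while the energy varies continuously. The same
displacement keeps the point away from the ends of the supports, where Cramér's lower bound is
delicate; elsewhere that bound comes from tilting a truncated law (`exists_centred_tilt`).

All exceptional probabilities are exponentially small for each `N` separately. The first
Borel–Cantelli lemma therefore suffices, whatever the joint law for different `N`. -/

namespace WordGREM

/-! ### Sums of i.i.d. variables: the Chernoff bound and the tilting bound -/

section Cramer

lemma isProbabilityMeasure_sampleMeanLaw (lam : Measure ℝ) [IsProbabilityMeasure lam] (N : ℕ) :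
    IsProbabilityMeasure (sampleMeanLaw lam N) := by
  unfold sampleMeanLaw
  exact Measure.isProbabilityMeasure_map (by fun_prop)

lemma sampleMeanLaw_real_apply (lam : Measure ℝ) (N : ℕ) {s : Set ℝ} (hs : MeasurableSet s) :
    (sampleMeanLaw lam N).real s =
      (Measure.pi (fun _ : Fin N => lam)).real {x | (∑ j, x j) / (N : ℝ) ∈ s} := by
  unfold sampleMeanLaw
  rw [map_measureReal_apply (by fun_prop) hs]
  rfl

/-- The Chernoff bound for sample means. -/
lemma sampleMeanLaw_real_le_exp (lam : Measure ℝ) [IsProbabilityMeasure lam] {ρ : ℝ}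
    (hρ : ρ ∈ integrableExpSet id lam) (a : ℝ) {N : ℕ} (hN : 1 ≤ N) :
    (sampleMeanLaw lam N).real {u | a ≤ ρ * u} ≤ Real.exp (N * (cgf id lam ρ - a)) := by
  have hN' : (0 : ℝ) < N := by exact_mod_cast hN
  have hm : MeasurableSet {u : ℝ | a ≤ ρ * u} := measurableSet_le (by fun_prop) (by fun_prop)
  rw [sampleMeanLaw_real_apply _ _ hm]
  have hint : Integrable (fun u : ℝ => Real.exp (ρ * u)) lam := hρ
  have hI := Integrable.fintype_prod (ι := Fin N) (f := fun _ u => Real.exp (ρ * u))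
    (μ := fun _ => lam) (fun _ => hint)
  have hval := integral_fintype_prod_eq_pow (ι := Fin N) (𝕜 := ℝ) (μ := lam)
    (fun u : ℝ => Real.exp (ρ * u))
  have hmgf : (∫ u, Real.exp (ρ * u) ∂lam) = Real.exp (cgf id lam ρ) := by
    rw [exp_cgf (X := id) hρ]; rfl
  have key := mul_meas_ge_le_integral_of_nonneg (μ := Measure.pi (fun _ : Fin N => lam))
    (f := fun x => ∏ j, Real.exp (ρ * x j))
    (ae_of_all _ fun x => Finset.prod_nonneg fun j _ => (Real.exp_pos _).le) hI
    (Real.exp (N * a))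
  rw [hval, hmgf, Fintype.card_fin, ← Real.exp_nat_mul] at key
  have hset : {x : Fin N → ℝ | (∑ j, x j) / (N : ℝ) ∈ {u : ℝ | a ≤ ρ * u}} =
      {x | Real.exp (N * a) ≤ ∏ j, Real.exp (ρ * x j)} := by
    ext x
    simp only [Set.mem_ofPred_eq, ← Real.exp_sum, Real.exp_le_exp, ← Finset.mul_sum]
    rw [← mul_div_assoc, le_div_iff₀ hN', mul_comm a]
  rw [hset, mul_sub, Real.exp_sub, le_div_iff₀ (Real.exp_pos _), mul_comm]
  exact key

lemma sampleMeanLaw_real_ball_le_exp (lam : Measure ℝ) [IsProbabilityMeasure lam] {ρ : ℝ}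
    (hρ : ρ ∈ integrableExpSet id lam) (x ε : ℝ) {N : ℕ} (hN : 1 ≤ N) :
    (sampleMeanLaw lam N).real (Metric.ball x ε) ≤
      Real.exp (N * (cgf id lam ρ - (ρ * x - |ρ| * ε))) := by
  have := isProbabilityMeasure_sampleMeanLaw lam N
  refine le_trans (measureReal_mono ?_) (sampleMeanLaw_real_le_exp lam hρ _ hN)
  intro u hu
  rw [Metric.mem_ball, Real.dist_eq] at hu
  have h1 : |ρ * (u - x)| ≤ |ρ| * ε := by
    rw [abs_mul]; gcongr
  have := (abs_le.1 h1).1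
  simp only [Set.mem_ofPred_eq]
  linarith

/-- A tilting bound: if the weight `w ≤ exp (ρ g)` makes `g` centred, then the sums of `g` stay
in a linear window with at least the exponential rate `log ∫ w`. -/
lemma eventually_le_pi_real_abs_sum_lt {Y : Type*} [MeasurableSpace Y] (μ : Measure Y)
    [IsFiniteMeasure μ] {g w : Y → ℝ} (hg : Measurable g) {ρ : ℝ} (hw0 : ∀ y, 0 ≤ w y)
    (hwg : ∀ y, w y ≤ Real.exp (ρ * g y)) (hw : Integrable w μ)
    (hgw : Integrable (fun y => g y * w y) μ) (hggw : Integrable (fun y => g y ^ 2 * w y) μ)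
    (hmean : ∫ y, g y * w y ∂μ = 0) (hpos : 0 < ∫ y, w y ∂μ) {ε : ℝ} (hε : 0 < ε) :
    ∀ᶠ N : ℕ in atTop, (1 / 2) * (∫ y, w y ∂μ) ^ N * Real.exp (-(N * (|ρ| * ε))) ≤
      (Measure.pi (fun _ : Fin N => μ)).real {x | |∑ j, g (x j)| < N * ε} := by
  set φ := ∫ y, w y ∂μ with hφ
  set v := ∫ y, g y ^ 2 * w y ∂μ with hv
  -- Under the product weight the summands `g (x j)` are centred and independent, so only the
  -- diagonal of the squared sum survives.
  have hsecond : ∀ N : ℕ, Integrable (fun x : Fin N → Y => (∑ j, g (x j)) ^ 2 * ∏ l, w (x l))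
      (Measure.pi (fun _ => μ)) ∧
      ∫ x, (∑ j, g (x j)) ^ 2 * ∏ l, w (x l) ∂(Measure.pi (fun _ : Fin N => μ))
        = N * (v * φ ^ (N - 1)) := by
    intro N
    -- `H i j l` is the factor at coordinate `l` of `g (x i) * g (x j) * ∏ w`; it carries `g ^ 2`
    -- when `l = i = j`.
    let H : Fin N → Fin N → Fin N → Y → ℝ := fun i j l u =>
      w u * ((if l = i then g u else 1) * (if l = j then g u else 1))
    have hexp : (fun x : Fin N → Y => (∑ j, g (x j)) ^ 2 * ∏ l, w (x l)) =
        fun x => ∑ i, ∑ j, ∏ l, H i j l (x l) := by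
      funext x
      simp only [H, Finset.prod_mul_distrib, Finset.prod_ite_eq', Finset.mem_univ, if_true]
      rw [sq, Finset.sum_mul_sum, Finset.sum_mul]
      refine Finset.sum_congr rfl fun i _ => ?_
      rw [Finset.sum_mul]
      exact Finset.sum_congr rfl fun j _ => by ring
    have hHint : ∀ i j l, Integrable (H i j l) μ := by
      intro i j l
      by_cases h1 : l = i <;> by_cases h2 : l = j <;> simp only [H]
      · convert hggw using 2; rw [if_pos h1, if_pos h2]; ring
      · convert hgw using 2; rw [if_pos h1, if_neg h2]; ring
      · convert hgw using 2; rw [if_neg h1, if_pos h2]; ring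
      · convert hw using 2; rw [if_neg h1, if_neg h2]; ring
    have hprod : ∀ i j, Integrable (fun x : Fin N → Y => ∏ l, H i j l (x l))
        (Measure.pi (fun _ => μ)) := fun i j => Integrable.fintype_prod (hHint i j)
    have hval : ∀ i j, ∫ x, ∏ l, H i j l (x l) ∂(Measure.pi (fun _ : Fin N => μ)) =
        if i = j then v * φ ^ (N - 1) else 0 := by
      intro i j
      rw [integral_fintype_prod_eq_prod]
      split_ifs with hij
      · subst hij
        rw [← Finset.mul_prod_erase _ _ (Finset.mem_univ i)]
        congr 1
        · simp only [H, if_true, hv]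
          exact integral_congr_ae (ae_of_all _ fun u => by simp only; ring)
        · rw [Finset.prod_congr rfl (g := fun _ => φ), Finset.prod_const,
            Finset.card_erase_of_mem (Finset.mem_univ i), Finset.card_univ, Fintype.card_fin]
          intro l hl
          simp [H, Finset.ne_of_mem_erase hl, hφ]
      · refine Finset.prod_eq_zero (Finset.mem_univ i) ?_
        rw [← hmean]
        refine integral_congr_ae (ae_of_all _ fun u => ?_)
        simp only [H, if_true, if_neg hij]; ring
    refine ⟨?_, ?_⟩
    · rw [hexp]
      exact integrable_finsetSum _ fun i _ => integrable_finsetSum _ fun j _ => hprod i j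
    · rw [hexp, integral_finsetSum _ fun i _ => integrable_finsetSum _ fun j _ => hprod i j]
      rw [Finset.sum_congr rfl fun i _ => integral_finsetSum _ fun j _ => hprod i j]
      simp [hval]
  -- Beyond this threshold the Chebyshev term is at most half of the total weight `φ ^ N`, which is
  -- the origin of the factor `1 / 2`.
  have hlarge : ∀ᶠ N : ℕ in atTop, 2 * v / (φ * ε ^ 2) ≤ N :=
    tendsto_natCast_atTop_atTop.eventually_ge_atTop _
  filter_upwards [hlarge, eventually_ge_atTop 1] with N hN hN1
  have hN0 : (0 : ℝ) < N := by exact_mod_cast hN1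
  obtain ⟨hi2, hv2⟩ := hsecond N
  set π := Measure.pi (fun _ : Fin N => μ) with hπ
  have hi1 : Integrable (fun x : Fin N → Y => ∏ l, w (x l)) π :=
    Integrable.fintype_prod fun _ => hw
  have hv1 : ∫ x, ∏ l, w (x l) ∂π = φ ^ N := by
    rw [hπ, integral_fintype_prod_eq_pow, Fintype.card_fin]
  set W : Set (Fin N → Y) := {x | |∑ j, g (x j)| < N * ε} with hWdef
  have hWm : MeasurableSet W := measurableSet_lt (by fun_prop) (by fun_prop)
  -- The total weight is split at the window: inside, the weight is at most `exp (N |ρ| ε)`;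
  -- outside, the squared sum divided by `(N ε) ^ 2` is at least `1`.
  have hmain : φ ^ N ≤ Real.exp (N * (|ρ| * ε)) * π.real W + v * φ ^ (N - 1) / (N * ε ^ 2) := by
    have hle : ∀ x : Fin N → Y, ∏ l, w (x l) ≤
        W.indicator (fun _ => Real.exp (N * (|ρ| * ε))) x +
          ((∑ j, g (x j)) ^ 2 * ∏ l, w (x l)) / (N * ε) ^ 2 := by
      intro x
      have hp0 : 0 ≤ ∏ l, w (x l) := Finset.prod_nonneg fun l _ => hw0 _
      by_cases hx : x ∈ W
      · rw [Set.indicator_of_mem hx]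
        have : ∏ l, w (x l) ≤ Real.exp (N * (|ρ| * ε)) := by
          refine (Finset.prod_le_prod (fun l _ => hw0 _) fun l _ => hwg _).trans ?_
          rw [← Real.exp_sum, ← Finset.mul_sum, Real.exp_le_exp]
          refine (le_abs_self _).trans ?_
          rw [abs_mul]
          have : |∑ j, g (x j)| ≤ N * ε := le_of_lt hx
          calc _ ≤ |ρ| * (N * ε) := by gcongr
            _ = _ := by ring
        have h2 : 0 ≤ ((∑ j, g (x j)) ^ 2 * ∏ l, w (x l)) / (N * ε) ^ 2 := by positivity
        linarith
      · rw [Set.indicator_of_notMem hx, zero_add, le_div_iff₀ (by positivity), mul_comm]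
        have : N * ε ≤ |∑ j, g (x j)| := not_lt.1 hx
        have : (N * ε) ^ 2 ≤ (∑ j, g (x j)) ^ 2 := by
          rw [← sq_abs (∑ j, g (x j))]; gcongr
        gcongr
    have hii : Integrable (W.indicator (fun _ => Real.exp (N * (|ρ| * ε)))) π :=
      (integrable_const _).indicator hWm
    have := integral_mono hi1 (hii.add (hi2.div_const _)) hle
    simp only [Pi.add_apply] at this
    rw [hv1, integral_add hii (hi2.div_const _), integral_div, hv2,
      integral_indicator_const _ hWm, smul_eq_mul] at this
    refine this.trans (le_of_eq ?_)
    field_simp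
  have hsmall : v * φ ^ (N - 1) / (N * ε ^ 2) ≤ φ ^ N / 2 := by
    rw [div_le_iff₀ (by positivity)] at hN
    rw [div_le_div_iff₀ (by positivity) two_pos]
    obtain ⟨M, rfl⟩ : ∃ M, N = M + 1 := ⟨N - 1, by omega⟩
    simp only [Nat.add_sub_cancel]
    have : 0 ≤ φ ^ M := by positivity
    calc _ = φ ^ M * (2 * v) := by ring
      _ ≤ φ ^ M * (((M + 1 : ℕ) : ℝ) * (φ * ε ^ 2)) := by gcongr
      _ = _ := by ring
  rw [Real.exp_neg, ← div_eq_mul_inv, div_le_iff₀ (Real.exp_pos _)]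
  linarith

end Cramer

/-! ### The Cramér rate function, its lower bound, and linear tails -/

section CramerLower

lemma cramerRate_nonneg (lam : Measure ℝ) [IsProbabilityMeasure lam] (x : ℝ) :
    0 ≤ cramerRate lam x := by
  refine le_iSup₂_of_le 0 (by simp [integrableExpSet]) ?_
  simp

lemma le_cramerRate {lam : Measure ℝ} {ρ : ℝ} (hρ : ρ ∈ integrableExpSet id lam) (x : ℝ) :
    ((ρ * x - cgf id lam ρ : ℝ) : EReal) ≤ cramerRate lam x :=
  le_iSup₂_of_le (f := fun ρ (_ : ρ ∈ integrableExpSet id lam) =>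
    ((ρ * x - cgf id lam ρ : ℝ) : EReal)) ρ hρ le_rfl

/-- The rate is infinite beyond a point that almost surely bounds the variable. -/
lemma cramerRate_eq_top (lam : Measure ℝ) [IsProbabilityMeasure lam] {τ x' x : ℝ}
    (h : ∀ᵐ u ∂lam, τ * u ≤ τ * x') (hx : τ * x' < τ * x) : cramerRate lam x = ⊤ := by
  rw [EReal.eq_top_iff_forall_lt]
  intro y
  set d := τ * x - τ * x' with hd
  have hd0 : 0 < d := sub_pos.2 hx
  -- The tilt `r τ` has log-Laplace transform at most `r τ x'`, so the rate at `x` is at least `r d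
  -- = |y| + 1`, which exceeds `y`.
  set r := (|y| + 1) / d with hr
  have hr0 : 0 ≤ r := by positivity
  have hbound : ∀ᵐ u ∂lam, Real.exp (r * τ * u) ≤ Real.exp (r * (τ * x')) := by
    filter_upwards [h] with u hu
    rw [Real.exp_le_exp, mul_assoc]
    gcongr
  have hmem : r * τ ∈ integrableExpSet id lam := by
    refine Integrable.of_bound (C := Real.exp (r * (τ * x'))) (by fun_prop) ?_
    filter_upwards [hbound] with u hu
    rw [Real.norm_eq_abs, abs_of_pos (Real.exp_pos _)]
    exact hu
  refine lt_of_lt_of_le ?_ (le_cramerRate hmem x)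
  have hc : cgf id lam (r * τ) ≤ r * (τ * x') := by
    rw [cgf, Real.log_le_iff_le_exp (mgf_pos hmem)]
    have := integral_mono_ae (f := fun u => Real.exp (r * τ * u))
      (g := fun _ => Real.exp (r * (τ * x'))) hmem (integrable_const _) hbound
    simpa [mgf] using this
  rw [EReal.coe_lt_coe_iff]
  have hrd : r * d = |y| + 1 := by rw [hr]; field_simp
  have : r * τ * x = r * (τ * x') + r * d := by rw [hd]; ring
  linarith [le_abs_self y]

/-- Truncation: below the rate function, a tilt of a truncation of the law is centred at `x`. -/
lemma exists_centred_tilt (lam : Measure ℝ) [IsProbabilityMeasure lam] {x c : ℝ}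
    (hR : lam (Set.Ioi x) ≠ 0) (hL : lam (Set.Iio x) ≠ 0) (hc : cramerRate lam x < c) :
    ∃ (M : ℕ) (ρ : ℝ),
      ∫ u in Set.Icc (-(M : ℝ)) M, (u - x) * Real.exp (ρ * (u - x)) ∂lam = 0 ∧
      Real.exp (-c) ≤ ∫ u in Set.Icc (-(M : ℝ)) M, Real.exp (ρ * (u - x)) ∂lam := by
  set I : ℕ → Set ℝ := fun M => Set.Icc (-(M : ℝ)) M with hI
  have hIm : ∀ M, MeasurableSet (I M) := fun M => measurableSet_Icc
  have hImono : Monotone I := fun a b hab => by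
    have : (a : ℝ) ≤ b := by exact_mod_cast hab
    exact Set.Icc_subset_Icc (by linarith) this
  -- The tilt sought is a critical point of this truncated moment generating function: its
  -- derivative is the integral that has to vanish.
  set φ : ℕ → ℝ → ℝ := fun M => mgf (fun u : ℝ => u - x) (lam.restrict (I M)) with hφ
  have hφval : ∀ M ρ, φ M ρ = ∫ u in I M, Real.exp (ρ * (u - x)) ∂lam := fun M ρ => rfl
  have hint : ∀ M ρ, Integrable (fun u : ℝ => Real.exp (ρ * (u - x))) (lam.restrict (I M)) := by
    intro M ρ
    refine integrable_exp_mul_of_mem_Icc (a := -M - x) (b := M - x) (by fun_prop) ?_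
    filter_upwards [ae_restrict_mem (hIm M)] with u hu
    exact ⟨by linarith [hu.1], by linarith [hu.2]⟩
  have hset : ∀ M, interior (integrableExpSet (fun u : ℝ => u - x) (lam.restrict (I M))) =
      Set.univ := by
    intro M
    rw [Set.eq_univ_of_forall (s := integrableExpSet _ _) (hint M), interior_univ]
  have hcont : ∀ M, Continuous (φ M) := fun M => continuous_mgf (hint M)
  -- Mass to the right of `x` is already seen at a positive distance from `x` and inside a bounded
  -- window; the same holds on the left.
  obtain ⟨m₁, hm₁⟩ : ∃ m : ℕ, lam (I m ∩ Set.Ici (x + 1 / ((m : ℝ) + 1))) ≠ 0 := by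
    by_contra! hcon
    refine hR (measure_mono_null ?_ (measure_iUnion_null hcon))
    intro u hu
    obtain ⟨a, ha⟩ := exists_nat_ge |u|
    obtain ⟨b, hb⟩ := exists_nat_one_div_lt (K := ℝ) (ε := u - x) (sub_pos.2 hu)
    rw [Set.mem_iUnion]
    refine ⟨max a b, ?_, ?_⟩
    · have : |u| ≤ ((max a b : ℕ) : ℝ) := ha.trans (by exact_mod_cast le_max_left _ _)
      exact ⟨by linarith [(abs_le.1 this).1], (abs_le.1 this).2⟩
    · have : (1 : ℝ) / (((max a b : ℕ) : ℝ) + 1) ≤ 1 / ((b : ℝ) + 1) := by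
        gcongr; exact le_max_right _ _
      simp only [Set.mem_Ici]; linarith
  obtain ⟨m₂, hm₂⟩ : ∃ m : ℕ, lam (I m ∩ Set.Iic (x - 1 / ((m : ℝ) + 1))) ≠ 0 := by
    by_contra! hcon
    refine hL (measure_mono_null ?_ (measure_iUnion_null hcon))
    intro u hu
    obtain ⟨a, ha⟩ := exists_nat_ge |u|
    obtain ⟨b, hb⟩ := exists_nat_one_div_lt (K := ℝ) (ε := x - u) (sub_pos.2 hu)
    rw [Set.mem_iUnion]
    refine ⟨max a b, ?_, ?_⟩
    · have : |u| ≤ ((max a b : ℕ) : ℝ) := ha.trans (by exact_mod_cast le_max_left _ _)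
      exact ⟨by linarith [(abs_le.1 this).1], (abs_le.1 this).2⟩
    · have : (1 : ℝ) / (((max a b : ℕ) : ℝ) + 1) ≤ 1 / ((b : ℝ) + 1) := by
        gcongr; exact le_max_right _ _
      simp only [Set.mem_Iic]; linarith
  set a : ℝ := min (1 / ((m₁ : ℝ) + 1)) (1 / ((m₂ : ℝ) + 1)) with ha
  have ha0 : 0 < a := lt_min (by positivity) (by positivity)
  set η : ℝ := min (lam.real (I m₁ ∩ Set.Ici (x + 1 / ((m₁ : ℝ) + 1))))
    (lam.real (I m₂ ∩ Set.Iic (x - 1 / ((m₂ : ℝ) + 1)))) with hη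
  have hη0 : 0 < η := lt_min
    (ENNReal.toReal_pos hm₁ (measure_ne_top _ _)) (ENNReal.toReal_pos hm₂ (measure_ne_top _ _))
  set M₀ := max m₁ m₂ with hM₀
  -- Mass at distance at least `a` on both sides makes `φ M` grow exponentially in `|ρ|`, with
  -- constants that do not depend on `M`.
  have hcoer : ∀ M, M₀ ≤ M → ∀ ρ, η * Real.exp (|ρ| * a) ≤ φ M ρ := by
    intro M hM ρ
    have hmk := mul_meas_ge_le_integral_of_nonneg (μ := lam.restrict (I M))
      (f := fun u => Real.exp (ρ * (u - x))) (ae_of_all _ fun u => (Real.exp_pos _).le)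
      (hint M ρ) (Real.exp (|ρ| * a))
    refine le_trans ?_ hmk
    rw [mul_comm]
    refine mul_le_mul_of_nonneg_left ?_ (Real.exp_pos _).le
    rw [measureReal_restrict_apply' (hIm M)]
    rcases le_total 0 ρ with h0 | h0
    · refine (min_le_left _ _).trans (measureReal_mono ?_)
      rintro u ⟨hu1, hu2⟩
      refine ⟨?_, hImono ((le_max_left _ _).trans hM) hu1⟩
      simp only [Set.mem_ofPred_eq, Real.exp_le_exp, abs_of_nonneg h0]
      have h3 : a ≤ u - x := (min_le_left _ _).trans (by linarith [Set.mem_Ici.1 hu2])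
      gcongr
    · refine (min_le_right _ _).trans (measureReal_mono ?_)
      rintro u ⟨hu1, hu2⟩
      refine ⟨?_, hImono ((le_max_right _ _).trans hM) hu1⟩
      simp only [Set.mem_ofPred_eq, Real.exp_le_exp, abs_of_nonpos h0]
      have h3 : a ≤ x - u := (min_le_right _ _).trans (by linarith [Set.mem_Iic.1 hu2])
      nlinarith
  have hφ0 : ∀ M, φ M 0 ≤ 1 := by
    intro M
    rw [hφval]
    simp
  set R : ℝ := 1 / (η * a) with hRdef
  have hfar : ∀ M, M₀ ≤ M → ∀ ρ, φ M ρ ≤ 1 → |ρ| ≤ R := by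
    intro M hM ρ hle
    have h1 := (hcoer M hM ρ).trans hle
    have h2 : |ρ| * a ≤ Real.exp (|ρ| * a) := by linarith [Real.add_one_le_exp (|ρ| * a)]
    rw [hRdef, le_div_iff₀ (by positivity)]
    nlinarith
  have hmin : ∀ M, M₀ ≤ M → ∃ ρ, ∀ ρ', φ M ρ ≤ φ M ρ' := by
    intro M hM
    refine (hcont M).exists_forall_le' 0 ?_
    have := (tendsto_norm_cocompact_atTop (E := ℝ)).eventually_gt_atTop R
    filter_upwards [this] with ρ hρ
    by_contra! hlt
    exact absurd (hfar M hM ρ (hlt.le.trans (hφ0 M))) (not_le.2 hρ)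
  -- Otherwise every minimum value is below `exp (-c)`. The minimisers stay in `[-R, R]`, and the
  -- sublevel sets decrease in `M`, so compactness gives one `ρ` that works for all large `M`.
  -- Removing the truncation gives `cgf ρ ≤ ρ x - c`, against `cramerRate lam x < c`.
  by_contra! hcon
  have hlow : ∀ M, M₀ ≤ M → ∃ ρ, φ M ρ ≤ Real.exp (-c) ∧ φ M ρ ≤ 1 := by
    intro M hM
    obtain ⟨ρ, hρ⟩ := hmin M hM
    refine ⟨ρ, ?_, (hρ 0).trans (hφ0 M)⟩
    have hder : HasDerivAt (φ M) _ ρ :=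
      hasDerivAt_mgf (X := fun u : ℝ => u - x) (μ := lam.restrict (I M)) (t := ρ)
        (by rw [hset]; trivial)
    have hz := (IsLocalMin.hasDerivAt_eq_zero (Eventually.of_forall hρ) hder)
    exact (hcon M ρ hz).le
  have hmono : ∀ ρ, Monotone fun M => φ M ρ := by
    intro ρ M M' hMM
    simp only [hφval]
    exact setIntegral_mono_set (hint M' ρ) (ae_of_all _ fun u => (Real.exp_pos _).le)
      (hImono hMM).eventuallyLE
  -- The condition `φ ≤ 1` is what confines these nested closed sets to `[-R, R]`.
  obtain ⟨ρ, hρ⟩ : (⋂ j : ℕ, {ρ | φ (M₀ + j) ρ ≤ Real.exp (-c) ∧ φ (M₀ + j) ρ ≤ 1}).Nonempty := by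
    have hcl : ∀ j : ℕ, IsClosed {ρ | φ (M₀ + j) ρ ≤ Real.exp (-c) ∧ φ (M₀ + j) ρ ≤ 1} := by
      intro j
      exact (isClosed_le (hcont _) continuous_const).inter
        (isClosed_le (hcont _) continuous_const)
    refine IsCompact.nonempty_iInter_of_sequence_nonempty_isCompact_isClosed _ ?_ ?_ ?_ hcl
    · intro j ρ hρ
      have := hmono ρ (show M₀ + j ≤ M₀ + (j + 1) by omega)
      exact ⟨this.trans hρ.1, this.trans hρ.2⟩
    · exact fun j => hlow _ (Nat.le_add_right _ _)
    · refine (isCompact_Icc (a := -R) (b := R)).of_isClosed_subset (hcl 0) ?_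
      intro ρ hρ
      exact abs_le.1 (hfar _ (Nat.le_add_right _ _) ρ hρ.2)
  have hbd : ∀ᶠ M in atTop, φ M ρ ≤ Real.exp (-c) := by
    filter_upwards [eventually_ge_atTop M₀] with M hM
    have := Set.mem_iInter.1 hρ (M - M₀)
    rw [Nat.add_sub_cancel' hM] at this
    exact this.1
  have hcov : AECover lam atTop I :=
    aecover_Icc (tendsto_neg_atTop_atBot.comp tendsto_natCast_atTop_atTop)
      tendsto_natCast_atTop_atTop
  have hIntegrable : Integrable (fun u : ℝ => Real.exp (ρ * (u - x))) lam := by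
    refine hcov.integrable_of_integral_norm_bounded (Real.exp (-c)) (fun M => hint M ρ) ?_
    filter_upwards [hbd] with M hM
    simpa [hφval] using hM
  have hle : ∫ u, Real.exp (ρ * (u - x)) ∂lam ≤ Real.exp (-c) :=
    le_of_tendsto (hcov.integral_tendsto_of_countably_generated hIntegrable) hbd
  have hfun : (fun u : ℝ => Real.exp (ρ * u)) =
      fun u => Real.exp (ρ * x) * Real.exp (ρ * (u - x)) := by
    funext u; rw [← Real.exp_add]; congr 1; ring
  have hmem : ρ ∈ integrableExpSet id lam := by
    change Integrable (fun u : ℝ => Real.exp (ρ * u)) lam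
    rw [hfun]; exact hIntegrable.const_mul _
  have hcgf : cgf id lam ρ ≤ ρ * x - c := by
    rw [cgf, Real.log_le_iff_le_exp (mgf_pos hmem)]
    change ∫ u : ℝ, Real.exp (ρ * u) ∂lam ≤ _
    rw [hfun, integral_const_mul, sub_eq_add_neg, Real.exp_add]
    gcongr
  have h1 := (le_cramerRate hmem x).trans_lt hc
  rw [EReal.coe_lt_coe_iff] at h1
  linarith

/-- From the tilting bound to sample means. -/
lemma eventually_exp_le_sampleMeanLaw_of_tilt (lam : Measure ℝ) [IsProbabilityMeasure lam]
    {x ρ c c' : ℝ} {w : ℝ → ℝ} (hw0 : ∀ y, 0 ≤ w y)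
    (hwg : ∀ y, w y ≤ Real.exp (ρ * (y - x))) (hw : Integrable w lam)
    (hgw : Integrable (fun y => (y - x) * w y) lam)
    (hggw : Integrable (fun y => (y - x) ^ 2 * w y) lam)
    (hmean : ∫ y, (y - x) * w y ∂lam = 0) (hval : Real.exp (-c') ≤ ∫ y, w y ∂lam)
    (hcc : c' < c) {ε : ℝ} (hε : 0 < ε) :
    ∀ᶠ N : ℕ in atTop, Real.exp (-(N * c)) ≤ (sampleMeanLaw lam N).real (Metric.ball x ε) := by
  -- Half of the gap `c - c'` pays for the tilt over a window of size `δ`, the other half absorbs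
  -- the factor `1 / 2` once `N` is large.
  set δ : ℝ := min ε ((c - c') / (2 * (|ρ| + 1))) with hδ
  have hρ0 := abs_nonneg ρ
  have hδ0 : 0 < δ := lt_min hε (div_pos (by linarith) (by positivity))
  have hρδ : |ρ| * δ ≤ (c - c') / 2 := by
    have h1 : δ ≤ (c - c') / (2 * (|ρ| + 1)) := min_le_right _ _
    rw [le_div_iff₀ (by positivity)] at h1
    nlinarith
  have key := eventually_le_pi_real_abs_sum_lt lam (g := fun y => y - x) (by fun_prop) hw0 hwg hw
    hgw hggw hmean ((Real.exp_pos _).trans_le hval) hδ0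
  have hlarge : ∀ᶠ N : ℕ in atTop, 2 * Real.log 2 / (c - c') ≤ N :=
    tendsto_natCast_atTop_atTop.eventually_ge_atTop _
  filter_upwards [key, hlarge, eventually_ge_atTop 1] with N hN hlN hN1
  have hN0 : (0 : ℝ) < N := by exact_mod_cast hN1
  have hlow : Real.exp (-(N * c)) ≤
      1 / 2 * (∫ y, w y ∂lam) ^ N * Real.exp (-(N * (|ρ| * δ))) := by
    have h2 : (Real.exp (-c')) ^ N ≤ (∫ y, w y ∂lam) ^ N := by gcongr
    refine le_trans ?_ (mul_le_mul_of_nonneg_right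
      (mul_le_mul_of_nonneg_left h2 (by norm_num)) (Real.exp_pos _).le)
    have h3 : (1 / 2 : ℝ) = Real.exp (-Real.log 2) := by
      rw [Real.exp_neg, Real.exp_log two_pos]; norm_num
    rw [h3, ← Real.exp_nat_mul, ← Real.exp_add, ← Real.exp_add, Real.exp_le_exp]
    rw [div_le_iff₀ (by linarith)] at hlN
    nlinarith
  refine hlow.trans (hN.trans ?_)
  rw [sampleMeanLaw_real_apply _ _ measurableSet_ball]
  refine measureReal_mono ?_
  intro y hy
  simp only [Set.mem_ofPred_eq, Finset.sum_sub_distrib, Finset.sum_const, Finset.card_univ,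
    Fintype.card_fin, nsmul_eq_mul, Metric.mem_ball, Real.dist_eq] at hy ⊢
  have h4 : (∑ j, y j) / (N : ℝ) - x = (∑ j, y j - N * x) / N := by field_simp
  rw [h4, abs_div, abs_of_pos hN0, div_lt_iff₀ hN0]
  have h5 : N * δ ≤ ε * N := by rw [mul_comm]; gcongr; exact min_le_left _ _
  exact hy.trans_le h5

/-- The Cramér lower bound at points with mass on both sides. -/
lemma eventually_exp_le_sampleMeanLaw (lam : Measure ℝ) [IsProbabilityMeasure lam] {x c : ℝ}
    (hR : lam (Set.Ioi x) ≠ 0) (hL : lam (Set.Iio x) ≠ 0) (hc : cramerRate lam x < c)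
    {ε : ℝ} (hε : 0 < ε) :
    ∀ᶠ N : ℕ in atTop, Real.exp (-(N * c)) ≤ (sampleMeanLaw lam N).real (Metric.ball x ε) := by
  obtain ⟨c', h1, h2⟩ := EReal.lt_iff_exists_real_btwn.1 hc
  obtain ⟨M, ρ, hmean, hval⟩ := exists_centred_tilt lam hR hL h1
  have hm : MeasurableSet (Set.Icc (-(M : ℝ)) M) := measurableSet_Icc
  set w : ℝ → ℝ := (Set.Icc (-(M : ℝ)) M).indicator fun u => Real.exp (ρ * (u - x)) with hw
  have hi : ∀ F : ℝ → ℝ, Continuous F → Integrable (fun y => F y * w y) lam ∧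
      ∫ y, F y * w y ∂lam = ∫ u in Set.Icc (-(M : ℝ)) M, F u * Real.exp (ρ * (u - x)) ∂lam := by
    intro F hF
    have he : (fun y => F y * w y) =
        (Set.Icc (-(M : ℝ)) M).indicator fun u => F u * Real.exp (ρ * (u - x)) := by
      funext y; rw [hw, Set.indicator_mul_right]
    rw [he, integrable_indicator_iff hm, integral_indicator hm]
    refine ⟨?_, rfl⟩
    exact (Continuous.continuousOn (by fun_prop)).integrableOn_compact isCompact_Icc
  have hi1 := hi (fun _ => 1) (by fun_prop)
  simp only [one_mul] at hi1
  refine eventually_exp_le_sampleMeanLaw_of_tilt lam (ρ := ρ) (w := w) (c' := c') ?_ ?_ hi1.1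
    (hi _ (by fun_prop)).1 (hi _ (by fun_prop)).1 ?_ ?_ (by exact_mod_cast h2) hε
  · exact fun y => Set.indicator_nonneg (fun u _ => (Real.exp_pos _).le) y
  · exact fun y => Set.indicator_le_self' (fun u _ => (Real.exp_pos _).le) y
  · rw [(hi _ (by fun_prop)).2, hmean]
  · rw [hi1.2]; exact hval

lemma integrable_id_of_exp {lam : Measure ℝ}
    (h : (0 : ℝ) ∈ interior (integrableExpSet id lam)) : Integrable (fun u : ℝ => u) lam :=
  integrable_of_mem_interior_integrableExpSet h

/-- Jensen's inequality for the log-Laplace transform. -/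
lemma mul_mean_le_cgf {lam : Measure ℝ} [IsProbabilityMeasure lam]
    (h : (0 : ℝ) ∈ interior (integrableExpSet id lam)) {ρ : ℝ}
    (hρ : ρ ∈ integrableExpSet id lam) : ρ * ∫ u, u ∂lam ≤ cgf id lam ρ := by
  rw [cgf, Real.le_log_iff_exp_le (mgf_pos hρ), ← integral_const_mul]
  exact convexOn_exp.map_integral_le Real.continuous_exp.continuousOn isClosed_univ
    (by simp) ((integrable_id_of_exp h).const_mul ρ) hρ

/-- Each affine function in the supremum is at most `a` at `x` and, by Jensen, at most `0` at the
mean; on the segment it is therefore at most `t * a`. -/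
lemma cramerRate_segment_le {lam : Measure ℝ} [IsProbabilityMeasure lam]
    (h : (0 : ℝ) ∈ interior (integrableExpSet id lam)) {x a t : ℝ} (ha : cramerRate lam x ≤ a)
    (ht0 : 0 ≤ t) (ht1 : t ≤ 1) :
    cramerRate lam ((∫ u, u ∂lam) + t * (x - ∫ u, u ∂lam)) ≤ ((t * a : ℝ) : EReal) := by
  refine iSup₂_le fun ρ hρ => ?_
  have h1 := (le_cramerRate hρ x).trans ha
  have h2 := mul_mean_le_cgf h hρ
  rw [EReal.coe_le_coe_iff] at h1 ⊢
  nlinarith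

/-- The Cramér lower bound along the segment from the mean to a point of finite rate. -/
lemma eventually_exp_le_sampleMeanLaw_segment {lam : Measure ℝ} [IsProbabilityMeasure lam]
    (h : (0 : ℝ) ∈ interior (integrableExpSet id lam)) {x a t c : ℝ} (ha : cramerRate lam x ≤ a)
    (ht0 : 0 ≤ t) (ht1 : t < 1) (hc : t * a < c) {ε : ℝ} (hε : 0 < ε) :
    ∀ᶠ N : ℕ in atTop, Real.exp (-(N * c)) ≤
      (sampleMeanLaw lam N).real (Metric.ball ((∫ u, u ∂lam) + t * (x - ∫ u, u ∂lam)) ε) := by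
  set m := ∫ u, u ∂lam with hm
  have hid := integrable_id_of_exp h
  have hrate := (cramerRate_segment_le h ha ht0 ht1.le).trans_lt (EReal.coe_lt_coe_iff.2 hc)
  have ha0 : 0 ≤ a := by exact_mod_cast (cramerRate_nonneg lam x).trans ha
  have hfin : cramerRate lam x ≠ ⊤ := fun hT => by simp [hT] at ha
  have hnull : ∀ {y : ℝ}, (∀ᵐ u ∂lam, y ≤ u) → y ≤ m := by
    intro y hy
    have := integral_mono_ae (integrable_const y) hid hy
    simpa using this
  have hnull' : ∀ {y : ℝ}, (∀ᵐ u ∂lam, u ≤ y) → m ≤ y := by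
    intro y hy
    have := integral_mono_ae hid (integrable_const y) hy
    simpa using this
  have hIoi : ∀ y : ℝ, lam (Set.Ioi y) = 0 → ∀ᵐ u ∂lam, u ≤ y := by
    intro y hy
    rw [ae_iff]; convert hy using 2; ext u; simp
  have hIio : ∀ y : ℝ, lam (Set.Iio y) = 0 → ∀ᵐ u ∂lam, y ≤ u := by
    intro y hy
    rw [ae_iff]; convert hy using 2; ext u; simp
  -- Off the mean, the point lies strictly between the mean and `x` because `t < 1`. No mass on the
  -- mean's side would contradict the value of the mean; no mass on the side of `x` would make the
  -- rate at `x` infinite.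
  rcases lt_trichotomy (t * (x - m)) 0 with hlt | heq | hgt
  · have ht : 0 < t := by
      rcases ht0.eq_or_lt with h0 | h0
      · simp [← h0] at hlt
      · exact h0
    have hxm : x < m := by nlinarith
    refine eventually_exp_le_sampleMeanLaw lam (fun h0 => ?_) (fun h0 => ?_) hrate hε
    · have := hnull' (hIoi _ h0); linarith
    · refine hfin (cramerRate_eq_top lam (τ := -1) (x' := m + t * (x - m)) ?_ (by nlinarith))
      filter_upwards [hIio _ h0] with u hu
      linarith
  -- At the mean no tilt is needed: with weight `1` the tilting bound is Chebyshev's weak law. This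
  -- case also covers a Dirac mass, which has no mass on either side.
  · rw [heq, add_zero]
    have hmem := memLp_of_mem_interior_integrableExpSet h 2
    have h2 : MemLp (fun y : ℝ => y - m) 2 lam := hmem.sub (memLp_const m)
    refine eventually_exp_le_sampleMeanLaw_of_tilt lam (ρ := 0) (w := fun _ => 1) (c' := 0)
      (by simp) (by simp) (by simp) ?_ ?_ ?_ (by simp) ?_ hε
    · simp only [mul_one]
      exact hid.sub (integrable_const m)
    · simpa using h2.integrable_sq
    · simp only [mul_one]
      rw [integral_sub hid (integrable_const m)]; simp [hm]
    · exact lt_of_le_of_lt (by positivity) hc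
  · have ht : 0 < t := by
      rcases ht0.eq_or_lt with h0 | h0
      · simp [← h0] at hgt
      · exact h0
    have hxm : m < x := by nlinarith
    refine eventually_exp_le_sampleMeanLaw lam (fun h0 => ?_) (fun h0 => ?_) hrate hε
    · refine hfin (cramerRate_eq_top lam (τ := 1) (x' := m + t * (x - m)) ?_ (by nlinarith))
      filter_upwards [hIoi _ h0] with u hu
      linarith
    · have := hnull (hIio _ h0); linarith

lemma cramerRate_mean {lam : Measure ℝ} [IsProbabilityMeasure lam]
    (h : (0 : ℝ) ∈ interior (integrableExpSet id lam)) :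
    cramerRate lam (∫ u, u ∂lam) = 0 := by
  refine le_antisymm (iSup₂_le fun ρ hρ => ?_) (cramerRate_nonneg _ _)
  have := mul_mean_le_cgf h hρ
  exact_mod_cast sub_nonpos.2 this

/-- The rate grows linearly, and so do the exponents of the tails of the sample means. -/
lemma exists_linear_tail {lam : Measure ℝ} [IsProbabilityMeasure lam]
    (h : (0 : ℝ) ∈ interior (integrableExpSet id lam)) :
    ∃ r > 0, ∃ C : ℝ, (∀ x, ((r * |x| - C : ℝ) : EReal) ≤ cramerRate lam x) ∧
      ∀ (L : ℝ) (N : ℕ), 1 ≤ N →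
        (sampleMeanLaw lam N).real {u | L ≤ |u|} ≤ 2 * Real.exp (N * (C - r * L)) := by
  rw [mem_interior_iff_mem_nhds, Metric.mem_nhds_iff] at h
  obtain ⟨r, hr, hsub⟩ := h
  have h1 : r / 2 ∈ integrableExpSet id lam := hsub (by
    rw [Metric.mem_ball, Real.dist_eq, sub_zero, abs_of_pos (half_pos hr)]; linarith)
  have h2 : -(r / 2) ∈ integrableExpSet id lam := hsub (by
    rw [Metric.mem_ball, Real.dist_eq, sub_zero, abs_neg, abs_of_pos (half_pos hr)]; linarith)
  refine ⟨r / 2, half_pos hr, max (cgf id lam (r / 2)) (cgf id lam (-(r / 2))), ?_, ?_⟩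
  · intro x
    rcases le_total 0 x with hx | hx
    · refine le_trans ?_ (le_cramerRate h1 x)
      rw [EReal.coe_le_coe_iff, abs_of_nonneg hx]
      gcongr; exact le_max_left _ _
    · refine le_trans ?_ (le_cramerRate h2 x)
      rw [EReal.coe_le_coe_iff, abs_of_nonpos hx, mul_neg, neg_mul]
      gcongr; exact le_max_right _ _
  · intro L N hN
    have := isProbabilityMeasure_sampleMeanLaw lam N
    have hcov : {u : ℝ | L ≤ |u|} ⊆
        {u | r / 2 * L ≤ r / 2 * u} ∪ {u | r / 2 * L ≤ -(r / 2) * u} := by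
      intro u hu
      rcases le_total 0 u with h0 | h0
      · left
        simp only [Set.mem_ofPred_eq, abs_of_nonneg h0] at hu ⊢
        gcongr
      · right
        simp only [Set.mem_ofPred_eq, abs_of_nonpos h0] at hu ⊢
        nlinarith
    refine (measureReal_mono hcov).trans ((measureReal_union_le _ _).trans ?_)
    rw [two_mul]
    refine add_le_add ((sampleMeanLaw_real_le_exp lam h1 _ hN).trans ?_)
      ((sampleMeanLaw_real_le_exp lam h2 _ hN).trans ?_)
    · gcongr; exact le_max_left _ _
    · gcongr; exact le_max_right _ _

end CramerLower

/-! ### Entropy of the spins and counting of blocks with prescribed magnetisation -/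

section Spin

/-- The finite part of the rate function of the spins. -/
noncomputable def spinEntropy (v : ℝ) : ℝ :=
  (1 + v) / 2 * Real.log (1 + v) + (1 - v) / 2 * Real.log (1 - v)

lemma spinRate_of_abs_le {v : ℝ} (hv : |v| ≤ 1) : spinRate v = (spinEntropy v : EReal) :=
  if_pos hv

lemma spinRate_of_lt_abs {v : ℝ} (hv : 1 < |v|) : spinRate v = ⊤ := if_neg (not_le.2 hv)

lemma spinEntropy_eq_mul_log (v : ℝ) : spinEntropy v =
    ((1 + v) * Real.log (1 + v) + (1 - v) * Real.log (1 - v)) / 2 := by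
  unfold spinEntropy; ring

lemma continuous_spinEntropy : Continuous spinEntropy := by
  have h : spinEntropy = fun v =>
      ((1 + v) * Real.log (1 + v) + (1 - v) * Real.log (1 - v)) / 2 :=
    funext spinEntropy_eq_mul_log
  rw [h]
  have h1 : Continuous fun v : ℝ => (1 + v) * Real.log (1 + v) :=
    Real.continuous_mul_log.comp (continuous_const.add continuous_id)
  have h2 : Continuous fun v : ℝ => (1 - v) * Real.log (1 - v) :=
    Real.continuous_mul_log.comp (continuous_const.sub continuous_id)
  exact (h1.add h2).div_const 2

lemma sub_one_le_mul_log {x : ℝ} (hx : 0 ≤ x) : x - 1 ≤ x * Real.log x := by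
  rcases hx.eq_or_lt with rfl | hx
  · simp
  · have := Real.one_sub_inv_le_log_of_pos hx
    calc x - 1 = x * (1 - x⁻¹) := by field_simp
      _ ≤ _ := by gcongr

lemma spinEntropy_nonneg {v : ℝ} (hv : |v| ≤ 1) : 0 ≤ spinEntropy v := by
  obtain ⟨h1, h2⟩ := abs_le.1 hv
  rw [spinEntropy_eq_mul_log]
  have := sub_one_le_mul_log (x := 1 + v) (by linarith)
  have := sub_one_le_mul_log (x := 1 - v) (by linarith)
  linarith

/-- Convexity of `x log x`, applied between `1 ± v` and `1`, where it vanishes. -/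
lemma spinEntropy_mul_le {t v : ℝ} (hv : |v| ≤ 1) (ht0 : 0 ≤ t) (ht1 : t ≤ 1) :
    spinEntropy (t * v) ≤ t * spinEntropy v := by
  obtain ⟨h1, h2⟩ := abs_le.1 hv
  have key : ∀ x : ℝ, 0 ≤ x →
      (t * x + (1 - t)) * Real.log (t * x + (1 - t)) ≤ t * (x * Real.log x) := by
    intro x hx
    have := Real.convexOn_mul_log.2 (x := x) (y := 1) (Set.mem_Ici.2 hx)
      (Set.mem_Ici.2 zero_le_one) ht0 (sub_nonneg.2 ht1) (by ring)
    simpa using this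
  have k1 := key (1 + v) (by linarith)
  have k2 := key (1 - v) (by linarith)
  rw [show t * (1 + v) + (1 - t) = 1 + t * v by ring] at k1
  rw [show t * (1 - v) + (1 - t) = 1 - t * v by ring] at k2
  rw [spinEntropy_eq_mul_log, spinEntropy_eq_mul_log]
  linarith

lemma spinRate_nonneg (v : ℝ) : 0 ≤ spinRate v := by
  rcases le_or_gt |v| 1 with h | h
  · rw [spinRate_of_abs_le h]; exact_mod_cast spinEntropy_nonneg h
  · rw [spinRate_of_lt_abs h]; exact le_top

/-- The optimal tilt for the magnetisation `v`. -/
noncomputable def spinTilt (v : ℝ) : ℝ := (Real.log (1 + v) - Real.log (1 - v)) / 2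

/-- With `exp_spinTilt_neg`: after centring at `v` and tilting, the two spins have weights
proportional to `1 + v` and `1 - v`, so the tilted mean is `v` and the total weight is `2 exp
(-spinEntropy v)`. -/
lemma exp_spinTilt_pos {v : ℝ} (hv : |v| < 1) :
    Real.exp (spinTilt v * (1 - v)) = (1 + v) * Real.exp (-spinEntropy v) := by
  obtain ⟨h1, h2⟩ := abs_lt.1 hv
  rw [← Real.exp_log (show 0 < 1 + v by linarith)]
  rw [← Real.exp_add]
  congr 1; unfold spinTilt spinEntropy; ring

lemma exp_spinTilt_neg {v : ℝ} (hv : |v| < 1) :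
    Real.exp (spinTilt v * (-1 - v)) = (1 - v) * Real.exp (-spinEntropy v) := by
  obtain ⟨h1, h2⟩ := abs_lt.1 hv
  rw [← Real.exp_log (show 0 < 1 - v by linarith)]
  rw [← Real.exp_add]
  congr 1; unfold spinTilt spinEntropy; ring

lemma spinTilt_mul_sub_log_cosh {v : ℝ} (hv : |v| < 1) :
    spinTilt v * v - Real.log (Real.cosh (spinTilt v)) = spinEntropy v := by
  have h : Real.cosh (spinTilt v) = Real.exp (spinTilt v * v - spinEntropy v) := by
    rw [Real.cosh_eq, div_eq_iff two_ne_zero]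
    have e1 : Real.exp (spinTilt v) =
        Real.exp (spinTilt v * (1 - v)) * Real.exp (spinTilt v * v) := by
      rw [← Real.exp_add]; congr 1; ring
    have e2 : Real.exp (-spinTilt v) =
        Real.exp (spinTilt v * (-1 - v)) * Real.exp (spinTilt v * v) := by
      rw [← Real.exp_add]; congr 1; ring
    rw [e1, e2, exp_spinTilt_pos hv, exp_spinTilt_neg hv,
      sub_eq_add_neg (spinTilt v * v), Real.exp_add]
    ring
  rw [h, Real.log_exp]; ring

lemma spinTilt_mul_nonneg {v : ℝ} (hv : |v| < 1) : 0 ≤ spinTilt v * v := by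
  obtain ⟨h1, h2⟩ := abs_lt.1 hv
  unfold spinTilt
  rcases le_total 0 v with h | h
  · have := Real.log_le_log (show 0 < 1 - v by linarith) (show 1 - v ≤ 1 + v by linarith)
    exact mul_nonneg (by linarith) h
  · have := Real.log_le_log (show 0 < 1 + v by linarith) (show 1 + v ≤ 1 - v by linarith)
    exact mul_nonneg_of_nonpos_of_nonpos (by linarith) h

/-- The spin rate is dominated by the Legendre transform of `log cosh`. -/
lemma exists_lt_mul_sub_log_cosh {v c : ℝ} (hc : (c : EReal) < spinRate v) :
    ∃ θ : ℝ, c < θ * v - Real.log (Real.cosh θ) := by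
  rcases le_or_gt |v| 1 with hv | hv
  · rw [spinRate_of_abs_le hv, EReal.coe_lt_coe_iff] at hc
    -- At `|v| = 1` there is no finite optimal tilt, so the tilt `θ` of `t * v` is used with `t < 1`
    -- close to `1`. It does at least as well at `v`, since `θ v ≥ 0` gives `θ v ≥ θ t v`.
    have hlim : Tendsto (fun t : ℝ => spinEntropy (t * v)) (𝓝[<] 1) (𝓝 (spinEntropy (1 * v))) :=
      ((continuous_spinEntropy.comp (continuous_id.mul continuous_const)).tendsto 1).mono_left
        nhdsWithin_le_nhds
    rw [one_mul] at hlim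
    obtain ⟨t, ⟨ht, ht1⟩, ht0⟩ := ((hlim.eventually_const_lt hc).and
      (eventually_mem_nhdsWithin)).and
        ((eventually_gt_nhds (show (0 : ℝ) < 1 by norm_num)).filter_mono nhdsWithin_le_nhds)
      |>.exists
    have ht1' : t < 1 := ht1
    have htv : |t * v| < 1 := by
      rw [abs_mul, abs_of_pos ht0]
      nlinarith [abs_nonneg v]
    refine ⟨spinTilt (t * v), ?_⟩
    have h1 := spinTilt_mul_sub_log_cosh htv
    have h2 := spinTilt_mul_nonneg htv
    have h3 : 0 ≤ spinTilt (t * v) * v := by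
      rw [show spinTilt (t * v) * (t * v) = t * (spinTilt (t * v) * v) by ring] at h2
      exact nonneg_of_mul_nonneg_right h2 ht0
    nlinarith
  -- Outside `[-1, 1]` the linear term beats `log cosh`: a tilt of size `r` in the direction of `v`
  -- gains at least `r (|v| - 1) = |c| + 1`.
  · have hcosh : ∀ θ : ℝ, Real.log (Real.cosh θ) ≤ |θ| := by
      intro θ
      rw [Real.log_le_iff_le_exp (Real.cosh_pos θ), ← Real.cosh_abs, Real.cosh_eq]
      have : Real.exp (-|θ|) ≤ Real.exp |θ| :=
        Real.exp_le_exp.2 (by linarith [abs_nonneg θ])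
      linarith
    set r := (|c| + 1) / (|v| - 1) with hr
    have hr0 : 0 ≤ r := div_nonneg (by positivity) (by linarith)
    have hrv : r * (|v| - 1) = |c| + 1 := div_mul_cancel₀ _ (by linarith)
    rcases le_total 0 v with h | h
    · refine ⟨r, ?_⟩
      have := hcosh r
      rw [abs_of_nonneg hr0] at this
      rw [abs_of_nonneg h] at hrv
      linarith [le_abs_self c]
    · refine ⟨-r, ?_⟩
      have := hcosh (-r)
      rw [abs_neg, abs_of_nonneg hr0] at this
      rw [abs_of_nonpos h] at hrv
      linarith [le_abs_self c]

open Classical in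
/-- The blocks of `k` spins whose sum is close to `N y`. -/
noncomputable def blockWindow (k N : ℕ) (y ε : ℝ) : Finset (Fin k → ℤˣ) :=
  Finset.univ.filter fun τ => (∑ j, ((τ j : ℤ) : ℝ)) / N ∈ Metric.ball y ε

lemma sum_units_int (F : ℤˣ → ℝ) : ∑ u, F u = F 1 + F (-1) := by
  rw [show (Finset.univ : Finset ℤˣ) = {1, -1} from rfl, Finset.sum_pair (by decide)]

/-- Chernoff's bound for the counting measure: the exponential weights of all the blocks add up to
`(2 cosh θ) ^ k`, and each block in the window contributes at least `exp (N (θ y - |θ| ε))`. -/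
lemma card_blockWindow_le (k : ℕ) {N : ℕ} (hN : 1 ≤ N) (y ε θ : ℝ) :
    ((blockWindow k N y ε).card : ℝ) ≤
      Real.exp (k * (Real.log 2 + Real.log (Real.cosh θ)) - N * (θ * y - |θ| * ε)) := by
  have hN0 : (0 : ℝ) < N := by exact_mod_cast hN
  have htot : ∑ τ : Fin k → ℤˣ, Real.exp (θ * ∑ j, ((τ j : ℤ) : ℝ)) =
      Real.exp (k * (Real.log 2 + Real.log (Real.cosh θ))) := by
    have h1 : ∀ τ : Fin k → ℤˣ, Real.exp (θ * ∑ j, ((τ j : ℤ) : ℝ)) =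
        ∏ j, Real.exp (θ * ((τ j : ℤ) : ℝ)) := by
      intro τ; rw [Finset.mul_sum, Real.exp_sum]
    simp_rw [h1]
    rw [← Fintype.prod_sum (fun (_ : Fin k) (u : ℤˣ) => Real.exp (θ * ((u : ℤ) : ℝ))),
      Finset.prod_const, Finset.card_univ, Fintype.card_fin, sum_units_int, Real.exp_nat_mul,
      Real.exp_add, Real.exp_log two_pos, Real.exp_log (Real.cosh_pos θ), Real.cosh_eq]
    congr 1
    simp
    ring
  rw [Real.exp_sub, le_div_iff₀ (Real.exp_pos _), ← htot, ← nsmul_eq_mul, ← Finset.sum_const]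
  refine (Finset.sum_le_sum fun τ hτ => ?_).trans
    (Finset.sum_le_sum_of_subset_of_nonneg (Finset.subset_univ (blockWindow k N y ε))
      fun _ _ _ => (Real.exp_pos _).le)
  rw [Real.exp_le_exp]
  simp only [blockWindow, Finset.mem_filter, Metric.mem_ball, Real.dist_eq] at hτ
  set s := ∑ j, ((τ j : ℤ) : ℝ) with hs
  have h1 : |θ * (s / N - y)| ≤ |θ| * ε := by
    rw [abs_mul]
    exact mul_le_mul_of_nonneg_left hτ.2.le (abs_nonneg θ)
  have h2 := (abs_le.1 h1).1
  calc N * (θ * y - |θ| * ε) ≤ N * (θ * (s / N)) := by gcongr; linarith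
    _ = θ * s := by field_simp

/-- The exponential upper bound for the number of blocks with a prescribed magnetisation. -/
lemma eventually_card_blockWindow_le {k : ℕ → ℕ} {p : ℝ} (hp : 0 < p)
    (hk : Tendsto (fun N : ℕ => (k N : ℝ) / N) atTop (𝓝 p)) {y c : ℝ}
    (hc : (c : EReal) < (p : EReal) * spinRate (y / p)) :
    ∃ ε > 0, ∀ᶠ N : ℕ in atTop,
      ((blockWindow (k N) N y ε).card : ℝ) ≤ Real.exp (N * (p * Real.log 2 - c)) := by
  have hc' : ((c / p : ℝ) : EReal) < spinRate (y / p) := by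
    rw [EReal.coe_div]
    rw [EReal.div_lt_iff (by exact_mod_cast hp) (EReal.coe_ne_top _), mul_comm]
    exact hc
  obtain ⟨θ, hθ⟩ := exists_lt_mul_sub_log_cosh hc'
  have hθ' : c < θ * y - p * Real.log (Real.cosh θ) := by
    rw [div_lt_iff₀ hp] at hθ
    have : (θ * (y / p) - Real.log (Real.cosh θ)) * p = θ * y - p * Real.log (Real.cosh θ) := by
      field_simp
    linarith
  set d := θ * y - p * Real.log (Real.cosh θ) - c with hd
  have hd0 : 0 < d := by linarith
  have hθ0 := abs_nonneg θ
  refine ⟨d / (2 * (|θ| + 1)), by positivity, ?_⟩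
  set ε := d / (2 * (|θ| + 1)) with hε
  have hεd : |θ| * ε < d := by
    have : ε * (2 * (|θ| + 1)) = d := div_mul_cancel₀ _ (by positivity)
    nlinarith [show 0 < ε by positivity]
  have hlim : Tendsto (fun N : ℕ => (k N : ℝ) / N * (Real.log 2 + Real.log (Real.cosh θ)) -
      (θ * y - |θ| * ε)) atTop
      (𝓝 (p * (Real.log 2 + Real.log (Real.cosh θ)) - (θ * y - |θ| * ε))) :=
    (hk.mul_const _).sub_const _
  have hlt : p * (Real.log 2 + Real.log (Real.cosh θ)) - (θ * y - |θ| * ε) <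
      p * Real.log 2 - c := by linarith
  filter_upwards [hlim.eventually_lt_const hlt, eventually_ge_atTop 1] with N hN hN1
  have hN0 : (0 : ℝ) < N := by exact_mod_cast hN1
  refine (card_blockWindow_le (k N) hN1 y ε θ).trans ?_
  rw [Real.exp_le_exp]
  have := mul_le_mul_of_nonneg_left hN.le hN0.le
  refine le_trans (le_of_eq ?_) this
  field_simp

lemma tendsto_atTop_of_div_tendsto {k : ℕ → ℕ} {p : ℝ} (hp : 0 < p)
    (hk : Tendsto (fun N : ℕ => (k N : ℝ) / N) atTop (𝓝 p)) : Tendsto k atTop atTop := by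
  rw [← tendsto_natCast_atTop_iff (R := ℝ)]
  have := hk.pos_mul_atTop hp (tendsto_natCast_atTop_atTop (R := ℝ))
  refine this.congr' ?_
  filter_upwards [eventually_ge_atTop 1] with N hN
  have hN0 : (N : ℝ) ≠ 0 := by positivity
  field_simp

/-- The exponential lower bound for the number of blocks with a prescribed magnetisation. -/
lemma eventually_le_card_blockWindow {k : ℕ → ℕ} {p : ℝ} (hp : 0 < p)
    (hk : Tendsto (fun N : ℕ => (k N : ℝ) / N) atTop (𝓝 p)) {v c : ℝ} (hv : |v| < 1)
    (hc : p * spinEntropy v < c) {ε : ℝ} (hε : 0 < ε) :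
    ∀ᶠ N : ℕ in atTop, Real.exp (N * (p * Real.log 2 - c)) ≤
      ((blockWindow (k N) N (p * v) ε).card : ℝ) := by
  -- The tilting bound holds for finite measures. Applied to the counting measure on the two spins,
  -- whose powers are counting measures, it counts blocks.
  let _ : MeasurableSpace ℤˣ := ⊤
  set ρ := spinTilt v with hρ
  set g : ℤˣ → ℝ := fun u => ((u : ℤ) : ℝ) - v with hg
  set w : ℤˣ → ℝ := fun u => Real.exp (ρ * g u) with hw
  have hw1 : w 1 = (1 + v) * Real.exp (-spinEntropy v) := by
    rw [← exp_spinTilt_pos hv]; simp [hw, hg, hρ]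
  have hw2 : w (-1) = (1 - v) * Real.exp (-spinEntropy v) := by
    rw [← exp_spinTilt_neg hv]; simp [hw, hg, hρ]
  have hg1 : g 1 = 1 - v := by simp [hg]
  have hg2 : g (-1) = -1 - v := by simp [hg]
  have hintegral : ∀ F : ℤˣ → ℝ, ∫ u, F u ∂Measure.count = F 1 + F (-1) := by
    intro F
    rw [integral_count, sum_units_int]
  have hφ : ∫ u, w u ∂Measure.count = Real.exp (Real.log 2 - spinEntropy v) := by
    rw [hintegral, hw1, hw2, sub_eq_add_neg (Real.log 2), Real.exp_add, Real.exp_log two_pos]; ring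
  have hρ0 := abs_nonneg ρ
  set d := c - p * spinEntropy v with hd
  have hd0 : 0 < d := sub_pos.2 hc
  -- The first bound keeps the tilted blocks inside the window of radius `ε`, the second keeps the
  -- cost of the tilt below the available gap `d`.
  set δ := min (ε / (2 * p)) (d / (2 * p * (|ρ| + 1))) with hδ
  have hδ0 : 0 < δ := lt_min (by positivity) (by positivity)
  have hδε : p * δ < ε := by
    have : δ ≤ ε / (2 * p) := min_le_left _ _
    rw [le_div_iff₀ (by positivity)] at this
    linarith
  have hδd : p * (|ρ| * δ) < d := by
    have : δ ≤ d / (2 * p * (|ρ| + 1)) := min_le_right _ _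
    rw [le_div_iff₀ (by positivity)] at this
    nlinarith [mul_pos hp hδ0]
  have key := eventually_le_pi_real_abs_sum_lt (Measure.count : Measure ℤˣ) (g := g) (w := w)
    (ρ := ρ) (measurable_from_top) (fun u => (Real.exp_pos _).le) (fun u => le_rfl)
    .of_finite .of_finite .of_finite
    (by rw [hintegral, hw1, hw2, hg1, hg2]; ring) (by rw [hφ]; exact Real.exp_pos _) hδ0
  have hpi : ∀ m : ℕ, (Measure.pi fun _ : Fin m => (Measure.count : Measure ℤˣ)) =
      Measure.count := by
    intro m
    refine Measure.ext_of_singleton fun τ => ?_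
    rw [Measure.pi_singleton]; simp
  have hktop := tendsto_atTop_of_div_tendsto hp hk
  have hlim1 : Tendsto (fun N : ℕ => (k N : ℝ) / N * (Real.log 2 - spinEntropy v - |ρ| * δ)
      - Real.log 2 / N) atTop (𝓝 (p * (Real.log 2 - spinEntropy v - |ρ| * δ) - 0)) :=
    (hk.mul_const _).sub (tendsto_const_div_atTop_nhds_zero_nat _)
  have hlt1 : p * Real.log 2 - c < p * (Real.log 2 - spinEntropy v - |ρ| * δ) - 0 := by linarith
  have hlim2 : Tendsto (fun N : ℕ => (k N : ℝ) / N * δ + |(k N : ℝ) / N - p| * |v|) atTop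
      (𝓝 (p * δ + |p - p| * |v|)) :=
    (hk.mul_const _).add ((hk.sub_const p).abs.mul_const _)
  have hlt2 : p * δ + |p - p| * |v| < ε := by simpa using hδε
  filter_upwards [hktop.eventually key, hlim1.eventually_const_lt hlt1,
    hlim2.eventually_lt_const hlt2, eventually_ge_atTop 1] with N hN h1 h2 hN1
  have hN0 : (0 : ℝ) < N := by exact_mod_cast hN1
  have hlow : Real.exp (N * (p * Real.log 2 - c)) ≤
      1 / 2 * (∫ u, w u ∂Measure.count) ^ (k N) * Real.exp (-(k N * (|ρ| * δ))) := by
    have h3 : (1 / 2 : ℝ) = Real.exp (-Real.log 2) := by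
      rw [Real.exp_neg, Real.exp_log two_pos]; norm_num
    rw [hφ, h3, ← Real.exp_nat_mul, ← Real.exp_add, ← Real.exp_add, Real.exp_le_exp]
    refine (mul_le_mul_of_nonneg_left h1.le hN0.le).trans (le_of_eq ?_)
    field_simp
    ring
  refine hlow.trans (hN.trans ?_)
  rw [hpi]
  have hsub : {τ : Fin (k N) → ℤˣ | |∑ j, g (τ j)| < k N * δ} ⊆
      (blockWindow (k N) N (p * v) ε : Set (Fin (k N) → ℤˣ)) := by
    intro τ hτ
    simp only [hg, Set.mem_ofPred_eq, Finset.sum_sub_distrib, Finset.sum_const, Finset.card_univ,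
      Fintype.card_fin, nsmul_eq_mul] at hτ
    simp only [blockWindow, Finset.coe_filter, Finset.mem_univ, true_and, Set.mem_ofPred_eq,
      Metric.mem_ball, Real.dist_eq]
    set s := ∑ j, ((τ j : ℤ) : ℝ) with hs
    -- The block has length `k N`, not `N p`; the second term is the resulting error, which vanishes
    -- in the limit.
    have e : s / N - p * v = (s - k N * v) / N + ((k N : ℝ) / N - p) * v := by ring
    rw [e]
    refine lt_of_le_of_lt (abs_add_le _ _) (lt_trans ?_ h2)
    rw [abs_mul, abs_div, abs_of_pos hN0]
    gcongr
    rw [div_mul_eq_mul_div]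
    gcongr
  refine (measureReal_mono hsub (by simp [Measure.count_apply_finset])).trans (le_of_eq ?_)
  simp [measureReal_def, Measure.count_apply_finset]

end Spin

/-! ### First and second moments of the number of good configurations -/

section Moments

variable {n : ℕ} {k : Fin n → ℕ} {S : Finset (List (Fin n))}

/-- The words of `S` all of whose symbols are in `A`. -/
def wordsIn (S : Finset (List (Fin n))) (A : Finset (Fin n)) : Finset S :=
  Finset.univ.filter fun t : S => ∀ i ∈ t.1, i ∈ A

lemma word_eq_word_iff {σ σ' : Config k} {s : List (Fin n)} :
    σ.word s = σ'.word s ↔ ∀ i ∈ s, σ i = σ' i := by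
  constructor
  · intro h i hi; exact congrFun h ⟨i, hi⟩
  · intro h; funext i; exact h i.1 i.2

open Classical in
/-- The configurations with blocks in `B` whose driving variables lie in the windows `V`. -/
noncomputable def goodConfigs (ξ : (s : S) → WordConfig k s → ℝ)
    (B : (i : Fin n) → Finset (Fin (k i) → ℤˣ)) (V : S → Set ℝ) : Finset (Config k) :=
  (Fintype.piFinset B).filter fun σ => ∀ s, ξ s (σ.word s) ∈ V s

open Classical in
lemma card_goodConfigs_eq_sum (B : (i : Fin n) → Finset (Fin (k i) → ℤˣ)) {Ω : Type*}
    {X : (s : S) → WordConfig k s → Ω → ℝ} {V : S → Set ℝ} (ω : Ω) :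
    ((goodConfigs (fun s τ => X s τ ω) B V).card : ℝ) = ∑ σ ∈ Fintype.piFinset B,
      {ω | ∀ s : S, X s (Config.word σ s) ω ∈ V s}.indicator (fun _ => (1 : ℝ)) ω := by
  rw [goodConfigs, Finset.card_filter]
  push_cast
  refine Finset.sum_congr rfl fun σ _ => ?_
  simp [Set.indicator_apply]

variable {Ω : Type*} [MeasurableSpace Ω] {P : Measure Ω}
  {X : (s : S) → WordConfig k s → Ω → ℝ} {ν : S → Measure ℝ} {V : S → Set ℝ}

/-- `HasLaw` only provides almost everywhere measurability, hence events that are null measurable.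
-/
lemma nullMeasurableSet_of_law (hX : ∀ s τ, HasLaw (X s τ) (ν s) P)
    (hV : ∀ s, MeasurableSet (V s)) (D : (s : S) → Finset (WordConfig k s)) :
    NullMeasurableSet {ω | ∀ s : S, ∀ τ ∈ D s, X s τ ω ∈ V s} P := by
  have : {ω | ∀ s : S, ∀ τ ∈ D s, X s τ ω ∈ V s} = ⋂ s, ⋂ τ ∈ D s, X s τ ⁻¹' V s := by
    ext ω; simp
  rw [this]
  exact NullMeasurableSet.iInter fun s => NullMeasurableSet.biInter (D s).countable_toSet
    fun τ _ => (hX s τ).aemeasurable.nullMeasurableSet_preimage (hV s)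

/-- The probability that finitely many of the driving variables lie in their windows. -/
lemma prob_forall_mem_eq_prod (hX : ∀ s τ, HasLaw (X s τ) (ν s) P)
    (hind : iIndepFun (fun a : (s : S) × WordConfig k s => X a.1 a.2) P)
    (hV : ∀ s, MeasurableSet (V s)) (D : (s : S) → Finset (WordConfig k s)) :
    P.real {ω | ∀ s : S, ∀ τ ∈ D s, X s τ ω ∈ V s} = ∏ s, (ν s).real (V s) ^ (D s).card := by
  have h := hind.measure_inter_preimage_eq_mul (S := Finset.univ.sigma D)
    (sets := fun a => V a.1) (fun a _ => hV a.1)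
  have hset : {ω | ∀ s : S, ∀ τ ∈ D s, X s τ ω ∈ V s} =
      ⋂ a ∈ Finset.univ.sigma D, (fun ω => X a.1 a.2 ω) ⁻¹' V a.1 := by
    ext ω
    simp only [Set.mem_ofPred_eq, Set.mem_iInter, Finset.mem_sigma, Finset.mem_univ, true_and,
      Set.mem_preimage]
    exact ⟨fun h a ha => h a.1 a.2 ha, fun h s τ hτ => h ⟨s, τ⟩ hτ⟩
  rw [measureReal_def, hset, h, ENNReal.toReal_prod, Finset.prod_sigma]
  refine Finset.prod_congr rfl fun s _ => ?_
  rw [← Finset.prod_const]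
  refine Finset.prod_congr rfl fun τ _ => ?_
  have := (hX s τ).measureReal_eq (p := fun u => u ∈ V s) (hV s)
  exact this

lemma prob_config_eq_prod (hX : ∀ s τ, HasLaw (X s τ) (ν s) P)
    (hind : iIndepFun (fun a : (s : S) × WordConfig k s => X a.1 a.2) P)
    (hV : ∀ s, MeasurableSet (V s)) (σ : Config k) (U : Finset S) :
    P.real {ω | ∀ s : S, s ∈ U → X s (σ.word s) ω ∈ V s} = ∏ s ∈ U, (ν s).real (V s) := by
  classical
  have h := prob_forall_mem_eq_prod hX hind hV fun s => if s ∈ U then {σ.word s} else ∅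
  have hset : {ω | ∀ s : S, s ∈ U → X s (σ.word s) ω ∈ V s} =
      {ω | ∀ s : S, ∀ τ ∈ (if s ∈ U then {σ.word s} else ∅ : Finset (WordConfig k s)),
        X s τ ω ∈ V s} := by
    ext ω
    refine forall_congr' fun s => ?_
    by_cases hs : s ∈ U <;> simp [hs]
  rw [hset, h, ← Finset.prod_subset (Finset.subset_univ U)]
  · refine Finset.prod_congr rfl fun s hs => ?_
    simp [hs]
  · intro s _ hs; simp [hs]

/-- A word on whose symbols the two configurations agree reads one common variable and costs its
probability once; any other word reads two independent variables. -/
lemma prob_pair_eq_prod (hX : ∀ s τ, HasLaw (X s τ) (ν s) P)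
    (hind : iIndepFun (fun a : (s : S) × WordConfig k s => X a.1 a.2) P)
    (hV : ∀ s, MeasurableSet (V s)) (σ σ' : Config k) :
    P.real ({ω | ∀ s : S, X s (σ.word s) ω ∈ V s} ∩ {ω | ∀ s : S, X s (σ'.word s) ω ∈ V s}) =
      ∏ s : S, if ∀ i ∈ s.1, σ i = σ' i then (ν s).real (V s) else (ν s).real (V s) ^ 2 := by
  classical
  have h := prob_forall_mem_eq_prod hX hind hV fun s => {σ.word s, σ'.word s}
  have hset : {ω | ∀ s : S, X s (σ.word s) ω ∈ V s} ∩ {ω | ∀ s : S, X s (σ'.word s) ω ∈ V s} =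
      {ω | ∀ s : S, ∀ τ ∈ ({σ.word s, σ'.word s} : Finset (WordConfig k s)), X s τ ω ∈ V s} := by
    ext ω; simp [forall_and]
  rw [hset, h]
  refine Finset.prod_congr rfl fun s _ => ?_
  simp only [← word_eq_word_iff]
  split_ifs with he
  · simp [he]
  · rw [Finset.card_pair he]

lemma nullMeasurableSet_config (hX : ∀ s τ, HasLaw (X s τ) (ν s) P)
    (hV : ∀ s, MeasurableSet (V s)) (σ : Config k) :
    NullMeasurableSet {ω | ∀ s : S, X s (σ.word s) ω ∈ V s} P := by
  have := nullMeasurableSet_of_law hX hV fun s => {σ.word s}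
  simpa using this

variable [IsProbabilityMeasure P]

/-- The first moment bound for the existence of a configuration, seen through the blocks of `A`. -/
lemma prob_exists_config_le (hX : ∀ s τ, HasLaw (X s τ) (ν s) P)
    (hind : iIndepFun (fun a : (s : S) × WordConfig k s => X a.1 a.2) P)
    (hV : ∀ s, MeasurableSet (V s)) (B : (i : Fin n) → Finset (Fin (k i) → ℤˣ))
    (A : Finset (Fin n)) :
    P.real {ω | ∃ σ : Config k, (∀ i, σ i ∈ B i) ∧ ∀ s : S, X s (σ.word s) ω ∈ V s} ≤
      (∏ i ∈ A, ((B i).card : ℝ)) * ∏ s ∈ wordsIn S A, (ν s).real (V s) := by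
  classical
  -- Words written in `A` do not see the blocks outside `A`. Freezing those blocks at `1` leaves a
  -- union bound over the blocks of `A` only.
  set B' : (i : Fin n) → Finset (Fin (k i) → ℤˣ) := fun i => if i ∈ A then B i else {1} with hB'
  have hsub : {ω | ∃ σ : Config k, (∀ i, σ i ∈ B i) ∧ ∀ s : S, X s (σ.word s) ω ∈ V s} ⊆
      ⋃ σ ∈ Fintype.piFinset B', {ω | ∀ s : S, s ∈ wordsIn S A → X s (Config.word σ s) ω ∈ V s} := by
    rintro ω ⟨σ, hσ, hω⟩
    simp only [Set.mem_iUnion]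
    refine ⟨fun i => if i ∈ A then σ i else 1, ?_, ?_⟩
    · rw [Fintype.mem_piFinset]
      intro i
      by_cases hi : i ∈ A <;> simp [hB', hi, hσ]
    · intro s hs
      have hs' : ∀ i ∈ s.1, i ∈ A := (Finset.mem_filter.1 hs).2
      have : Config.word (fun i => if i ∈ A then σ i else 1) s.1 = σ.word s.1 :=
        word_eq_word_iff.2 fun i hi => if_pos (hs' i hi)
      rw [this]
      exact hω s
  refine (measureReal_mono hsub (measure_ne_top _ _)).trans
    ((measureReal_biUnion_finset_le _ _).trans ?_)
  rw [Finset.sum_congr rfl fun σ _ => prob_config_eq_prod hX hind hV σ (wordsIn S A),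
    Finset.sum_const, nsmul_eq_mul, Fintype.card_piFinset, Nat.cast_prod]
  refine le_of_eq ?_
  congr 1
  rw [← Finset.prod_subset (Finset.subset_univ A)]
  · exact Finset.prod_congr rfl fun i hi => by simp [hB', hi]
  · intro i _ hi; simp [hB', hi]

lemma integrable_indicator_one_of_null {s : Set Ω} (hs : NullMeasurableSet s P) :
    Integrable (s.indicator fun _ => (1 : ℝ)) P ∧
      ∫ ω, s.indicator (fun _ => (1 : ℝ)) ω ∂P = P.real s := by
  refine ⟨(integrable_const _).indicator₀ hs, ?_⟩
  rw [integral_indicator₀ hs]; simp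

open Classical in
lemma integral_card_goodConfigs (hX : ∀ s τ, HasLaw (X s τ) (ν s) P)
    (hind : iIndepFun (fun a : (s : S) × WordConfig k s => X a.1 a.2) P)
    (hV : ∀ s, MeasurableSet (V s)) (B : (i : Fin n) → Finset (Fin (k i) → ℤˣ)) :
    Integrable (fun ω => ((goodConfigs (fun s τ => X s τ ω) B V).card : ℝ)) P ∧
    ∫ ω, ((goodConfigs (fun s τ => X s τ ω) B V).card : ℝ) ∂P =
      (∏ i, ((B i).card : ℝ)) * ∏ s, (ν s).real (V s) := by
  have hi := fun σ : Config k =>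
    integrable_indicator_one_of_null (nullMeasurableSet_config hX hV σ)
  simp_rw [card_goodConfigs_eq_sum]
  refine ⟨integrable_finsetSum _ fun σ _ => (hi σ).1, ?_⟩
  rw [integral_finsetSum _ fun σ _ => (hi σ).1]
  have hval : ∀ σ : Config k, ∫ ω, {ω | ∀ s : S, X s (Config.word σ s) ω ∈ V s}.indicator
      (fun _ => (1 : ℝ)) ω ∂P = ∏ s, (ν s).real (V s) := by
    intro σ
    rw [(hi σ).2]
    simpa using prob_config_eq_prod hX hind hV σ Finset.univ
  rw [Finset.sum_congr rfl fun σ _ => hval σ, Finset.sum_const, nsmul_eq_mul,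
    Fintype.card_piFinset, Nat.cast_prod]

/-- Markov's inequality for the number of good configurations. -/
lemma prob_le_card_goodConfigs (hX : ∀ s τ, HasLaw (X s τ) (ν s) P)
    (hind : iIndepFun (fun a : (s : S) × WordConfig k s => X a.1 a.2) P)
    (hV : ∀ s, MeasurableSet (V s)) (B : (i : Fin n) → Finset (Fin (k i) → ℤˣ)) {a : ℝ}
    (ha : 0 < a) :
    P.real {ω | a ≤ (goodConfigs (fun s τ => X s τ ω) B V).card} ≤
      ((∏ i, ((B i).card : ℝ)) * ∏ s, (ν s).real (V s)) / a := by
  obtain ⟨h1, h2⟩ := integral_card_goodConfigs hX hind hV B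
  rw [le_div_iff₀ ha, mul_comm, ← h2]
  exact mul_meas_ge_le_integral_of_nonneg (ae_of_all _ fun ω => Nat.cast_nonneg _) h1 a

/-- The sum over the second configuration in the second moment, split according to the set of
blocks on which the two configurations agree. -/
lemma sum_prob_pair_le (B : (i : Fin n) → Finset (Fin (k i) → ℤˣ)) {q : S → ℝ}
    (hq : ∀ s, 0 ≤ q s) {σ : Config k} (hσ : σ ∈ Fintype.piFinset B) :
    (∑ σ' ∈ Fintype.piFinset B, ∏ s : S, if ∀ i ∈ s.1, σ i = σ' i then q s else q s ^ 2) ≤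
      ∑ A : Finset (Fin n), (∏ i ∈ Aᶜ, ((B i).card : ℝ)) *
        ((∏ s ∈ wordsIn S A, q s) * ∏ s ∈ (wordsIn S A)ᶜ, q s ^ 2) := by
  classical
  have hcount : ∀ A : Finset (Fin n), (∑ σ' ∈ Fintype.piFinset B,
      ∏ i, (if i ∈ A then (if σ i = σ' i then (1 : ℝ) else 0) else 1)) =
        ∏ i ∈ Aᶜ, ((B i).card : ℝ) := by
    intro A
    rw [← Finset.prod_univ_sum B
      (fun i τ => if i ∈ A then (if σ i = τ then (1 : ℝ) else 0) else 1),
      ← Finset.prod_mul_prod_compl A]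
    rw [Finset.prod_eq_one, one_mul]
    · refine Finset.prod_congr rfl fun i hi => ?_
      simp [Finset.mem_compl.1 hi]
    · intro i hi
      simp [hi, Fintype.mem_piFinset.1 hσ i]
  have hprodeq : ∀ A : Finset (Fin n),
      (∏ s : S, if s ∈ wordsIn S A then q s else q s ^ 2) =
        (∏ s ∈ wordsIn S A, q s) * ∏ s ∈ (wordsIn S A)ᶜ, q s ^ 2 := by
    intro A
    rw [← Finset.prod_mul_prod_compl (wordsIn S A)]
    congr 1
    · exact Finset.prod_congr rfl fun s hs => if_pos hs
    · exact Finset.prod_congr rfl fun s hs => if_neg (Finset.mem_compl.1 hs)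
  -- The term for the exact agreement set of `σ` and `σ'` is the left side. Adding the non-negative
  -- terms of all other `A` on which they agree makes the count factorise over the blocks.
  calc (∑ σ' ∈ Fintype.piFinset B, ∏ s : S, if ∀ i ∈ s.1, σ i = σ' i then q s else q s ^ 2)
      ≤ ∑ σ' ∈ Fintype.piFinset B, ∑ A : Finset (Fin n),
          (∏ i, (if i ∈ A then (if σ i = σ' i then (1 : ℝ) else 0) else 1)) *
            ∏ s : S, if s ∈ wordsIn S A then q s else q s ^ 2 := by
        refine Finset.sum_le_sum fun σ' _ => ?_
        have hnn : ∀ A ∈ (Finset.univ : Finset (Finset (Fin n))),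
            0 ≤ (∏ i, (if i ∈ A then (if σ i = σ' i then (1 : ℝ) else 0) else 1)) *
              ∏ s : S, if s ∈ wordsIn S A then q s else q s ^ 2 := by
          intro A _
          refine mul_nonneg (Finset.prod_nonneg fun i _ => ?_) (Finset.prod_nonneg fun s _ => ?_)
          · split_ifs <;> norm_num
          · split_ifs
            · exact hq s
            · exact sq_nonneg _
        refine le_trans (le_of_eq ?_) (Finset.single_le_sum hnn
          (Finset.mem_univ (Finset.univ.filter fun i => σ i = σ' i)))
        have hone : (∏ i, (if i ∈ Finset.univ.filter fun i => σ i = σ' i then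
            (if σ i = σ' i then (1 : ℝ) else 0) else 1)) = 1 := by
          refine Finset.prod_eq_one fun i _ => ?_
          by_cases h : σ i = σ' i <;> simp [h]
        rw [hone, one_mul]
        refine Finset.prod_congr rfl fun s _ => ?_
        simp [wordsIn]
    _ = ∑ A : Finset (Fin n), (∏ i ∈ Aᶜ, ((B i).card : ℝ)) *
        ((∏ s ∈ wordsIn S A, q s) * ∏ s ∈ (wordsIn S A)ᶜ, q s ^ 2) := by
        rw [Finset.sum_comm]
        refine Finset.sum_congr rfl fun A _ => ?_
        rw [← Finset.sum_mul, hcount, hprodeq]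

/-- The second moment bound: the number of good configurations is at least half its mean, unless
the expected number of partial configurations on some set of blocks is small. -/
lemma prob_card_goodConfigs_lt (hS : ∀ s ∈ S, s ≠ [])
    (hX : ∀ s τ, HasLaw (X s τ) (ν s) P)
    (hind : iIndepFun (fun a : (s : S) × WordConfig k s => X a.1 a.2) P)
    (hV : ∀ s, MeasurableSet (V s)) (B : (i : Fin n) → Finset (Fin (k i) → ℤˣ))
    (hB : ∀ i, 0 < ((B i).card : ℝ)) (hq : ∀ s, 0 < (ν s).real (V s)) :
    P.real {ω | ((goodConfigs (fun s τ => X s τ ω) B V).card : ℝ) <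
        ((∏ i, ((B i).card : ℝ)) * ∏ s, (ν s).real (V s)) / 2} ≤
      4 * ∑ A ∈ Finset.univ.erase (∅ : Finset (Fin n)),
        ((∏ i ∈ A, ((B i).card : ℝ)) * ∏ s ∈ wordsIn S A, (ν s).real (V s))⁻¹ := by
  classical
  set q : S → ℝ := fun s => (ν s).real (V s) with hqdef
  set b : Fin n → ℝ := fun i => ((B i).card : ℝ) with hbdef
  set m : ℝ := (∏ i, b i) * ∏ s, q s with hm
  have hm0 : 0 < m := mul_pos (Finset.prod_pos fun i _ => hB i) (Finset.prod_pos fun s _ => hq s)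
  set W : Ω → ℝ := fun ω => ((goodConfigs (fun s τ => X s τ ω) B V).card : ℝ) with hW
  obtain ⟨hW1, hWm⟩ := integral_card_goodConfigs hX hind hV B
  set E : Config k → Set Ω := fun σ => {ω | ∀ s : S, X s (σ.word s) ω ∈ V s} with hE
  have hnull : ∀ σ, NullMeasurableSet (E σ) P := nullMeasurableSet_config hX hV
  have hpair := fun σ σ' : Config k =>
    integrable_indicator_one_of_null ((hnull σ).inter (hnull σ'))
  have hWsq : (fun ω => W ω ^ 2) = fun ω => ∑ σ ∈ Fintype.piFinset B,
      ∑ σ' ∈ Fintype.piFinset B, (E σ ∩ E σ').indicator (fun _ => (1 : ℝ)) ω := by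
    funext ω
    simp only [hW]
    rw [card_goodConfigs_eq_sum, sq, Finset.sum_mul_sum]
    refine Finset.sum_congr rfl fun σ _ => Finset.sum_congr rfl fun σ' _ => ?_
    simp only [Set.indicator_apply, Set.mem_inter_iff, ← ite_and, mul_ite, mul_one, mul_zero, hE,
      and_comm]
  have hW2i : Integrable (fun ω => W ω ^ 2) P := by
    rw [hWsq]
    exact integrable_finsetSum _ fun σ _ => integrable_finsetSum _ fun σ' _ => (hpair σ σ').1
  have hW2 : ∫ ω, W ω ^ 2 ∂P ≤ m ^ 2 + m ^ 2 *
      ∑ A ∈ Finset.univ.erase (∅ : Finset (Fin n)),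
        ((∏ i ∈ A, b i) * ∏ s ∈ wordsIn S A, q s)⁻¹ := by
    rw [hWsq, integral_finsetSum _ fun σ _ => integrable_finsetSum _ fun σ' _ => (hpair σ σ').1,
      Finset.sum_congr rfl fun σ _ => integral_finsetSum _ fun σ' _ => (hpair σ σ').1]
    -- Compared with `m ^ 2`, a pair agreeing on `A` saves one factor for each block of `A` and for
    -- each word in `A`.
    have hterm : ∀ A : Finset (Fin n), (∏ i, b i) * ((∏ i ∈ Aᶜ, b i) *
        ((∏ s ∈ wordsIn S A, q s) * ∏ s ∈ (wordsIn S A)ᶜ, q s ^ 2)) =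
          m ^ 2 * ((∏ i ∈ A, b i) * ∏ s ∈ wordsIn S A, q s)⁻¹ := by
      intro A
      have hbA : 0 < ∏ i ∈ A, b i := Finset.prod_pos fun i _ => hB i
      have hqA : 0 < ∏ s ∈ wordsIn S A, q s := Finset.prod_pos fun s _ => hq s
      rw [hm, ← Finset.prod_mul_prod_compl A b, ← Finset.prod_mul_prod_compl (wordsIn S A) q,
        Finset.prod_pow]
      field_simp
    -- Since words are non-empty, `A = ∅` contributes exactly `m ^ 2`, which the variance subtracts.
    have hempty : wordsIn S (∅ : Finset (Fin n)) = ∅ := by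
      refine Finset.filter_eq_empty_iff.2 fun s _ h => ?_
      obtain ⟨i, hi⟩ := List.exists_mem_of_ne_nil s.1 (hS s.1 s.2)
      exact absurd (h i hi) (Finset.notMem_empty i)
    calc _ ≤ ∑ σ ∈ Fintype.piFinset B, ∑ A : Finset (Fin n), (∏ i ∈ Aᶜ, b i) *
        ((∏ s ∈ wordsIn S A, q s) * ∏ s ∈ (wordsIn S A)ᶜ, q s ^ 2) := by
          refine Finset.sum_le_sum fun σ hσ => ?_
          refine le_trans (le_of_eq ?_) (sum_prob_pair_le B (fun s => (hq s).le) hσ)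
          refine Finset.sum_congr rfl fun σ' _ => ?_
          rw [(hpair σ σ').2]
          exact prob_pair_eq_prod hX hind hV σ σ'
      _ = ∑ A : Finset (Fin n), m ^ 2 * ((∏ i ∈ A, b i) * ∏ s ∈ wordsIn S A, q s)⁻¹ := by
          rw [Finset.sum_const, nsmul_eq_mul, Fintype.card_piFinset, Nat.cast_prod,
            Finset.mul_sum]
          exact Finset.sum_congr rfl fun A _ => hterm A
      _ = _ := by
          rw [← Finset.mul_sum, ← Finset.add_sum_erase _ _ (Finset.mem_univ ∅), hempty]
          simp [mul_add]
  have hvar : ∫ ω, (W ω - m) ^ 2 ∂P = ∫ ω, W ω ^ 2 ∂P - m ^ 2 ∧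
      Integrable (fun ω => (W ω - m) ^ 2) P := by
    have he : (fun ω => (W ω - m) ^ 2) = fun ω => W ω ^ 2 - (2 * m) * W ω + m ^ 2 := by
      funext ω; ring
    have hi2 : Integrable (fun ω => (2 * m) * W ω) P := hW1.const_mul _
    have hi3 : Integrable (fun ω => W ω ^ 2 - (2 * m) * W ω) P := hW2i.sub hi2
    rw [he]
    refine ⟨?_, hi3.add (integrable_const _)⟩
    rw [integral_add hi3 (integrable_const _), integral_sub hW2i hi2, integral_const_mul, hWm]
    simp only [integral_const, probReal_univ, smul_eq_mul, one_mul]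
    ring
  have hcheb := mul_meas_ge_le_integral_of_nonneg (ae_of_all P fun ω => sq_nonneg (W ω - m))
    hvar.2 (m ^ 2 / 4)
  have hsub : {ω | W ω < m / 2} ⊆ {ω | m ^ 2 / 4 ≤ (W ω - m) ^ 2} := by
    intro ω hω
    simp only [Set.mem_ofPred_eq] at hω ⊢
    nlinarith
  have h1 : m ^ 2 / 4 * P.real {ω | W ω < m / 2} ≤ m ^ 2 *
      ∑ A ∈ Finset.univ.erase (∅ : Finset (Fin n)),
        ((∏ i ∈ A, b i) * ∏ s ∈ wordsIn S A, q s)⁻¹ := by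
    refine (mul_le_mul_of_nonneg_left (measureReal_mono hsub)
      (div_nonneg (sq_nonneg m) (by norm_num))).trans (hcheb.trans ?_)
    rw [hvar.1]
    linarith
  have hmm : 0 < m ^ 2 / 4 := div_pos (pow_pos hm0 2) (by norm_num)
  refine le_of_mul_le_mul_left (h1.trans (le_of_eq ?_)) hmm
  ring

end Moments

/-! ### Borel–Cantelli -/

/-- The first Borel–Cantelli lemma for exponentially small events. -/
lemma ae_eventually_notMem_of_exp {Ω : Type*} [MeasurableSpace Ω] {P : Measure Ω}
    [IsProbabilityMeasure P] {E : ℕ → Set Ω} {C η : ℝ} (hη : 0 < η)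
    (hE : ∀ᶠ N : ℕ in atTop, P.real (E N) ≤ C * Real.exp (-(N * η))) :
    ∀ᵐ ω ∂P, ∀ᶠ N in atTop, ω ∉ E N := by
  have hsum : Summable fun N : ℕ => C * Real.exp (-(N * η)) := by
    refine Summable.mul_left _ ?_
    have := Real.summable_exp_nat_mul_iff.2 (neg_lt_zero.2 hη)
    simpa using this
  have hsum' : Summable fun N => P.real (E N) := by
    refine hsum.of_norm_bounded_eventually_nat ?_
    filter_upwards [hE] with N hN
    rwa [Real.norm_of_nonneg measureReal_nonneg]
  refine ae_eventually_notMem ?_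
  have h2 : ∀ N, P (E N) = ENNReal.ofReal (P.real (E N)) := fun N => by
    rw [ofReal_measureReal]
  simp_rw [h2]
  exact hsum'.tsum_ofReal_ne_top

/-! ### Splitting strict lower bounds for extended-real sums -/

section EReal

/-- Distributes a real lower bound over the summands even when they are infinite, so that finite and
infinite rates are treated alike. -/
lemma exists_real_lt_add {a b : EReal} {c : ℝ} (h : (c : EReal) < a + b) :
    ∃ a' b' : ℝ, (a' : EReal) < a ∧ (b' : EReal) < b ∧ c < a' + b' := by
  by_contra! hcon
  refine absurd (EReal.add_le_of_forall_lt fun a' ha' b' hb' => ?_) (not_le.2 h)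
  induction a' with
  | bot => simp
  | top => exact absurd ha' not_top_lt
  | coe a' =>
    induction b' with
    | bot => simp
    | top => exact absurd hb' not_top_lt
    | coe b' => exact_mod_cast hcon a' b' ha' hb'

lemma exists_real_lt_sum {ι : Type*} (T : Finset ι) (a : ι → EReal) {c : ℝ}
    (h : (c : EReal) < ∑ i ∈ T, a i) :
    ∃ c' : ι → ℝ, (∀ i ∈ T, (c' i : EReal) < a i) ∧ c < ∑ i ∈ T, c' i := by
  classical
  induction T using Finset.induction_on generalizing c with
  | empty =>
    refine ⟨0, by simp, ?_⟩
    simpa using h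
  | insert j T hj ih =>
    rw [Finset.sum_insert hj] at h
    obtain ⟨a', b', ha', hb', hlt⟩ := exists_real_lt_add h
    obtain ⟨c', hc', hsum⟩ := ih hb'
    refine ⟨Function.update c' j a', ?_, ?_⟩
    · intro i hi
      rcases eq_or_ne i j with rfl | hij
      · simpa using ha'
      · rw [Function.update_of_ne hij]
        exact hc' i ((Finset.mem_insert.1 hi).resolve_left hij)
    · rw [Finset.sum_insert hj, Function.update_self, Finset.sum_update_of_notMem hj]
      linarith

lemma coe_finset_sum {ι : Type*} (T : Finset ι) (a : ι → ℝ) :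
    ((∑ i ∈ T, a i : ℝ) : EReal) = ∑ i ∈ T, (a i : EReal) :=
  map_sum (⟨⟨Real.toEReal, EReal.coe_zero⟩, EReal.coe_add⟩ : ℝ →+ EReal) a T

end EReal

/-! ### Exponential bounds for small windows -/

/-- A small window has small probability, at the exponential rate given by the rate function. -/
lemma eventually_ball_le_exp (lam : Measure ℝ) [IsProbabilityMeasure lam] {x c : ℝ}
    (hc : (c : EReal) < cramerRate lam x) :
    ∀ᶠ ε in 𝓝[>] (0 : ℝ), ∀ᶠ N : ℕ in atTop,
      (sampleMeanLaw lam N).real (Metric.ball x ε) ≤ Real.exp (-(N * c)) := by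
  obtain ⟨ρ, hρ, hlt⟩ := by simpa only [cramerRate, lt_iSup_iff, exists_prop] using hc
  rw [EReal.coe_lt_coe_iff] at hlt
  have hlim : Tendsto (fun ε : ℝ => |ρ| * ε) (𝓝[>] 0) (𝓝 (|ρ| * 0)) :=
    ((continuous_const.mul continuous_id).tendsto 0).mono_left nhdsWithin_le_nhds
  rw [mul_zero] at hlim
  filter_upwards [hlim.eventually_lt_const (sub_pos.2 hlt)] with ε hε
  filter_upwards [eventually_ge_atTop 1] with N hN
  refine (sampleMeanLaw_real_ball_le_exp lam hρ x ε hN).trans ?_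
  rw [Real.exp_le_exp, ← mul_neg]
  gcongr
  linarith

lemma eventually_small_card_blockWindow_le {k : ℕ → ℕ} {p : ℝ} (hp : 0 < p)
    (hk : Tendsto (fun N : ℕ => (k N : ℝ) / N) atTop (𝓝 p)) {y c : ℝ}
    (hc : (c : EReal) < (p : EReal) * spinRate (y / p)) :
    ∀ᶠ ε in 𝓝[>] (0 : ℝ), ∀ᶠ N : ℕ in atTop,
      ((blockWindow (k N) N y ε).card : ℝ) ≤ Real.exp (N * (p * Real.log 2 - c)) := by
  obtain ⟨ε₀, hε₀, h⟩ := eventually_card_blockWindow_le hp hk hc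
  filter_upwards [Ioo_mem_nhdsGT hε₀] with ε hε
  filter_upwards [h] with N hN
  refine le_trans ?_ hN
  have : blockWindow (k N) N y ε ⊆ blockWindow (k N) N y ε₀ := by
    intro τ hτ
    simp only [blockWindow, Finset.mem_filter] at hτ ⊢
    exact ⟨hτ.1, Metric.ball_subset_ball hε.2.le hτ.2⟩
  exact_mod_cast Finset.card_le_card this

/-! ### The domain of the rate function -/

section Domain

variable {n : ℕ} {S : Finset (List (Fin n))} {lam : S → Measure ℝ} {p : Fin n → ℝ}

lemma mul_spinRate_nonneg {p : ℝ} (hp : 0 < p) (v : ℝ) : 0 ≤ (p : EReal) * spinRate v :=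
  mul_nonneg (by exact_mod_cast hp.le) (spinRate_nonneg v)

/-- The expected number of partial configurations near `z` on the blocks of `A`. -/
lemma eventually_partial_mean_le (hlam : ∀ s, IsProbabilityMeasure (lam s)) (hp : ∀ i, 0 < p i)
    {k : ℕ → Fin n → ℕ}
    (hk : ∀ i, Tendsto (fun N : ℕ => (k N i : ℝ) / (N : ℝ)) atTop (𝓝 (p i)))
    {z : (S → ℝ) × (Fin n → ℝ)} {A : Finset (Fin n)} {c : ℝ}
    (hc : (c : EReal) < rateSum S lam p A z) :
    ∀ᶠ ε in 𝓝[>] (0 : ℝ), ∀ᶠ N : ℕ in atTop,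
      (∏ i ∈ A, ((blockWindow (k N i) N (z.2 i) ε).card : ℝ)) *
        ∏ s ∈ wordsIn S A, (sampleMeanLaw (lam s) N).real (Metric.ball (z.1 s) ε) ≤
      Real.exp (N * (∑ i ∈ A, p i * Real.log 2 - c)) := by
  obtain ⟨c₁, c₂, h1, h2, h12⟩ := exists_real_lt_add hc
  obtain ⟨a, ha, hac⟩ := exists_real_lt_sum _ _ h1
  obtain ⟨b, hb, hbc⟩ := exists_real_lt_sum _ _ h2
  have hw : ∀ᶠ ε in 𝓝[>] (0 : ℝ), ∀ s ∈ wordsIn S A, ∀ᶠ N : ℕ in atTop,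
      (sampleMeanLaw (lam s) N).real (Metric.ball (z.1 s) ε) ≤ Real.exp (-(N * a s)) :=
    (Filter.eventually_all_finset _).2 fun s hs =>
      have := hlam s
      eventually_ball_le_exp (lam s) (ha s hs)
  have hblk : ∀ᶠ ε in 𝓝[>] (0 : ℝ), ∀ i ∈ A, ∀ᶠ N : ℕ in atTop,
      ((blockWindow (k N i) N (z.2 i) ε).card : ℝ) ≤
        Real.exp (N * (p i * Real.log 2 - b i)) :=
    (Filter.eventually_all_finset _).2 fun i hi =>
      eventually_small_card_blockWindow_le (k := fun N => k N i) (hp i) (hk i) (hb i hi)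
  filter_upwards [hw, hblk] with ε hε1 hε2
  filter_upwards [(Filter.eventually_all_finset _).2 hε1,
    (Filter.eventually_all_finset _).2 hε2] with N hN1 hN2
  refine (mul_le_mul (Finset.prod_le_prod (fun i _ => Nat.cast_nonneg _) hN2)
    (Finset.prod_le_prod (fun s _ => measureReal_nonneg) hN1)
    (Finset.prod_nonneg fun s _ => measureReal_nonneg)
    (Finset.prod_nonneg fun i _ => (Real.exp_pos _).le)).trans ?_
  have hac' : c₁ < ∑ s ∈ wordsIn S A, a s := hac
  rw [← Real.exp_sum, ← Real.exp_sum, ← Real.exp_add, Real.exp_le_exp]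
  refine le_trans (le_of_eq ?_) (mul_le_mul_of_nonneg_left
    (show ∑ i ∈ A, p i * Real.log 2 - (∑ i ∈ A, b i + ∑ s ∈ wordsIn S A, a s) ≤
      ∑ i ∈ A, p i * Real.log 2 - c by linarith) (Nat.cast_nonneg N))
  rw [Finset.sum_neg_distrib, ← Finset.mul_sum, ← Finset.mul_sum, Finset.sum_sub_distrib]
  ring

/-- The real form of membership in the domain of the rate function. -/
lemma exists_real_of_mem_rateDomain (hlam : ∀ s, IsProbabilityMeasure (lam s))
    (hp : ∀ i, 0 < p i) {z : (S → ℝ) × (Fin n → ℝ)} (hz : z ∈ rateDomain S lam p) :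
    ∃ a : S → ℝ, (∀ s, cramerRate (lam s) (z.1 s) = a s) ∧ (∀ i, |z.2 i / p i| ≤ 1) ∧
      rate S lam p z =
        ((∑ s, a s + ∑ i, p i * spinEntropy (z.2 i / p i) : ℝ) : EReal) ∧
      ∀ A : Finset (Fin n), rateSum S lam p A z =
          ((∑ s ∈ wordsIn S A, a s + ∑ i ∈ A, p i * spinEntropy (z.2 i / p i) : ℝ) : EReal) ∧
        ∑ s ∈ wordsIn S A, a s + ∑ i ∈ A, p i * spinEntropy (z.2 i / p i) ≤
          ∑ i ∈ A, p i * Real.log 2 := by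
  have hcr : ∀ s, 0 ≤ cramerRate (lam s) (z.1 s) := fun s =>
    have := hlam s
    cramerRate_nonneg _ _
  have hsp : ∀ i, 0 ≤ (p i : EReal) * spinRate (z.2 i / p i) := fun i =>
    mul_spinRate_nonneg (hp i) _
  have huniv := hz Finset.univ
  rw [rateSum] at huniv
  have hlt := huniv.trans_lt (EReal.coe_lt_top _)
  have hfilter : (Finset.univ.filter fun t : S => ∀ i ∈ t.1, i ∈ (Finset.univ : Finset (Fin n)))
      = Finset.univ := by simp
  rw [hfilter] at hlt
  have hs1 : ∀ s, cramerRate (lam s) (z.1 s) ≠ ⊤ := by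
    intro s
    refine ne_of_lt (lt_of_le_of_lt ?_ hlt)
    refine (Finset.single_le_sum (f := fun s => cramerRate (lam s) (z.1 s))
      (fun s _ => hcr s) (Finset.mem_univ s)).trans ?_
    exact le_add_of_nonneg_right (Finset.sum_nonneg fun i _ => hsp i)
  have hs2 : ∀ i, (p i : EReal) * spinRate (z.2 i / p i) ≠ ⊤ := by
    intro i
    refine ne_of_lt (lt_of_le_of_lt ?_ hlt)
    refine (Finset.single_le_sum (f := fun i => (p i : EReal) * spinRate (z.2 i / p i))
      (fun i _ => hsp i) (Finset.mem_univ i)).trans ?_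
    exact le_add_of_nonneg_left (Finset.sum_nonneg fun s _ => hcr s)
  have habs : ∀ i, |z.2 i / p i| ≤ 1 := by
    intro i
    by_contra! h
    refine hs2 i ?_
    rw [spinRate_of_lt_abs h, EReal.coe_mul_top_of_pos (hp i)]
  have hspin : ∀ i, (p i : EReal) * spinRate (z.2 i / p i) =
      ((p i * spinEntropy (z.2 i / p i) : ℝ) : EReal) := by
    intro i; rw [spinRate_of_abs_le (habs i), EReal.coe_mul]
  have ha : ∀ s, cramerRate (lam s) (z.1 s) = ((cramerRate (lam s) (z.1 s)).toReal : EReal) :=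
    fun s => (EReal.coe_toReal (hs1 s) (ne_of_gt (EReal.bot_lt_zero.trans_le (hcr s)))).symm
  have hA : ∀ A : Finset (Fin n), rateSum S lam p A z =
      ((∑ s ∈ wordsIn S A, (cramerRate (lam s) (z.1 s)).toReal +
        ∑ i ∈ A, p i * spinEntropy (z.2 i / p i) : ℝ) : EReal) := by
    intro A
    rw [rateSum, EReal.coe_add, coe_finset_sum, coe_finset_sum]
    congr 1
    · exact Finset.sum_congr rfl fun s _ => ha s
    · exact Finset.sum_congr rfl fun i _ => hspin i
  refine ⟨fun s => (cramerRate (lam s) (z.1 s)).toReal, ha, habs, ?_, fun A => ⟨hA A, ?_⟩⟩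
  · rw [rate, if_pos hz, EReal.coe_add, coe_finset_sum, coe_finset_sum]
    congr 1
    · exact Finset.sum_congr rfl fun s _ => ha s
    · exact Finset.sum_congr rfl fun i _ => hspin i
  · have := hz A
    rw [hA A] at this
    exact_mod_cast this

lemma wordsIn_univ : wordsIn S (Finset.univ : Finset (Fin n)) = Finset.univ := by
  simp [wordsIn]

/-- The typical point belongs to the domain, with rate `0`. -/
lemma mean_mem_rateDomain (hlam : ∀ s, IsProbabilityMeasure (lam s))
    (hexp : ∀ s, (0 : ℝ) ∈ interior (integrableExpSet id (lam s))) (hp : ∀ i, 0 < p i) :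
    ((fun s => ∫ u, u ∂(lam s)), fun _ => 0) ∈ rateDomain S lam p ∧
      rate S lam p ((fun s => ∫ u, u ∂(lam s)), fun _ => 0) = 0 := by
  have h1 : ∀ s, cramerRate (lam s) (∫ u, u ∂(lam s)) = 0 := fun s =>
    have := hlam s
    cramerRate_mean (hexp s)
  have h2 : spinRate 0 = 0 := by
    rw [spinRate_of_abs_le (by simp)]; simp [spinEntropy]
  have hmem : ((fun s => ∫ u, u ∂(lam s)), fun _ => 0) ∈ rateDomain S lam p := by
    intro A
    simp only [rateSum, h1, zero_div, h2, mul_zero, Finset.sum_const_zero, add_zero]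
    have : 0 ≤ ∑ i ∈ A, p i * Real.log 2 := Finset.sum_nonneg fun i _ =>
      mul_nonneg (hp i).le (Real.log_nonneg one_le_two)
    exact_mod_cast this
  refine ⟨hmem, ?_⟩
  rw [rate, if_pos hmem]
  simp [h1, h2]

/-- The domain is bounded. -/
lemma exists_bound_rateDomain (hlam : ∀ s, IsProbabilityMeasure (lam s))
    (hexp : ∀ s, (0 : ℝ) ∈ interior (integrableExpSet id (lam s))) (hp : ∀ i, 0 < p i) :
    ∃ R : ℝ, ∀ z ∈ rateDomain S lam p, ‖z‖ ≤ R := by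
  choose r hr C hC _ using fun s =>
    have := hlam s
    exists_linear_tail (hexp s)
  -- The constraint for the full set of blocks bounds every rate by `T`, and the rates of the words
  -- grow at least linearly.
  set T := ∑ i, p i * Real.log 2 with hT
  obtain ⟨R₁, hR₁⟩ := (Set.finite_range fun s => (T + C s) / r s).bddAbove
  obtain ⟨R₂, hR₂⟩ := (Set.finite_range p).bddAbove
  refine ⟨max 0 (max R₁ R₂), fun z hz => ?_⟩
  obtain ⟨a, ha, habs, -, hA⟩ := exists_real_of_mem_rateDomain hlam hp hz
  have hle := (hA Finset.univ).2
  rw [wordsIn_univ] at hle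
  have ha0 : ∀ s, 0 ≤ a s := fun s => by
    have := hlam s
    exact_mod_cast (cramerRate_nonneg (lam s) (z.1 s)).trans_eq (ha s)
  have hsp0 : ∀ i, 0 ≤ p i * spinEntropy (z.2 i / p i) := fun i =>
    mul_nonneg (hp i).le (spinEntropy_nonneg (habs i))
  rw [Prod.norm_def, max_le_iff, pi_norm_le_iff_of_nonneg (le_max_left _ _),
    pi_norm_le_iff_of_nonneg (le_max_left _ _)]
  refine ⟨fun s => ?_, fun i => ?_⟩
  · refine le_trans ?_ ((hR₁ ⟨s, rfl⟩).trans ((le_max_left _ _).trans (le_max_right _ _)))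
    have h1 := hC s (z.1 s)
    rw [ha s, EReal.coe_le_coe_iff] at h1
    have h2 : a s ≤ ∑ s, a s := Finset.single_le_sum (fun s _ => ha0 s) (Finset.mem_univ s)
    have h3 : 0 ≤ ∑ i, p i * spinEntropy (z.2 i / p i) := Finset.sum_nonneg fun i _ => hsp0 i
    rw [Real.norm_eq_abs, le_div_iff₀ (hr s)]
    linarith
  · refine le_trans ?_ ((hR₂ ⟨i, rfl⟩).trans ((le_max_right _ _).trans (le_max_right _ _)))
    have := habs i
    rwa [abs_div, abs_of_pos (hp i), div_le_one (hp i)] at this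

end Domain

/-! ### The model and its empirical vectors -/

/-- The standing assumptions of the word GREM. -/
structure IsWordGREM {n : ℕ} (S : Finset (List (Fin n))) (k : ℕ → Fin n → ℕ) (p : Fin n → ℝ)
    (lam : S → Measure ℝ) {Ω : Type*} [MeasurableSpace Ω] (P : Measure Ω)
    (ξ : (N : ℕ) → (s : S) → WordConfig (k N) s → Ω → ℝ) : Prop where
  one_le : 1 ≤ n
  ne_nil : ∀ s ∈ S, s ≠ []
  sum_eq : ∀ N, n ≤ N → ∑ i, k N i = N
  lim : ∀ i, Tendsto (fun N : ℕ => (k N i : ℝ) / (N : ℝ)) atTop (𝓝 (p i))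
  pos : ∀ i, 0 < p i
  prob : ∀ s, IsProbabilityMeasure (lam s)
  exp : ∀ s, (0 : ℝ) ∈ interior (integrableExpSet id (lam s))
  law : ∀ N, n ≤ N → ∀ (s : S) (τ : WordConfig (k N) s),
    HasLaw (ξ N s τ) (sampleMeanLaw (lam s) N) P
  indep : ∀ N, n ≤ N → iIndepFun (fun a : (s : S) × WordConfig (k N) s => ξ N a.1 a.2) P

section Empirical

variable {n : ℕ} {k : Fin n → ℕ} {S : Finset (List (Fin n))}

/-- The driving variables and the block magnetisations seen by a configuration. -/
noncomputable def empirical (N : ℕ) (ξ : (s : S) → WordConfig k s → ℝ) (σ : Config k) :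
    (S → ℝ) × (Fin n → ℝ) :=
  (fun s => ξ s (σ.word s), fun i => σ.blockSum i / N)

/-- The energy density as a function of the driving variables and the block magnetisations. -/
noncomputable def energy (f : (S → ℝ) → ℝ) (β h : ℝ) (z : (S → ℝ) × (Fin n → ℝ)) : ℝ :=
  β * f z.1 + β * h * ∑ i, z.2 i

lemma continuous_energy {f : (S → ℝ) → ℝ} (hf : Continuous f) (β h : ℝ) :
    Continuous (energy (n := n) f β h) := by
  unfold energy
  fun_prop

lemma partitionFunction_eq_sum (f : (S → ℝ) → ℝ) (β h : ℝ) {N : ℕ} (hN : 1 ≤ N)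
    (ξ : (s : S) → WordConfig k s → ℝ) :
    partitionFunction S f β h N ξ =
      ∑ σ : Config k, Real.exp (-(N * energy f β h (empirical N ξ σ))) := by
  have hN0 : (N : ℝ) ≠ 0 := by positivity
  refine Finset.sum_congr rfl fun σ _ => ?_
  congr 1
  simp only [hamiltonian, energy, empirical, ← Finset.sum_div]
  field_simp

lemma mem_ball_iff_forall {z w : (S → ℝ) × (Fin n → ℝ)} {ε : ℝ} (hε : 0 < ε) :
    w ∈ Metric.ball z ε ↔
      (∀ i, w.2 i ∈ Metric.ball (z.2 i) ε) ∧ ∀ s, w.1 s ∈ Metric.ball (z.1 s) ε := by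
  simp only [Metric.mem_ball]
  rw [Prod.dist_eq, max_lt_iff, dist_pi_lt_iff hε, dist_pi_lt_iff hε, and_comm]

lemma mem_goodConfigs {ξ : (s : S) → WordConfig k s → ℝ}
    {B : (i : Fin n) → Finset (Fin (k i) → ℤˣ)} {V : S → Set ℝ} {σ : Config k} :
    σ ∈ goodConfigs ξ B V ↔ (∀ i, σ i ∈ B i) ∧ ∀ s : S, ξ s (σ.word s) ∈ V s := by
  classical
  rw [goodConfigs, Finset.mem_filter, Fintype.mem_piFinset]

/-- Balls of the sup metric are products of one-dimensional windows, the form required by the moment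
bounds. -/
lemma mem_goodConfigs_iff {N : ℕ} {ξ : (s : S) → WordConfig k s → ℝ}
    {z : (S → ℝ) × (Fin n → ℝ)} {ε : ℝ} (hε : 0 < ε) {σ : Config k} :
    σ ∈ goodConfigs ξ (fun i => blockWindow (k i) N (z.2 i) ε)
      (fun s => Metric.ball (z.1 s) ε) ↔ empirical N ξ σ ∈ Metric.ball z ε := by
  rw [mem_ball_iff_forall hε, mem_goodConfigs]
  simp [blockWindow, empirical, Config.blockSum]

lemma card_config : Fintype.card (Config k) = 2 ^ ∑ i, k i := by
  simp [Config, Fintype.card_pi, Finset.prod_pow_eq_pow_sum]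

lemma abs_blockSum_le (σ : Config k) (i : Fin n) : |σ.blockSum i| ≤ k i := by
  refine (Finset.abs_sum_le_sum_abs _ _).trans (le_of_eq ?_)
  have : ∀ u : ℤˣ, |((u : ℤ) : ℝ)| = 1 := by
    intro u
    rcases Int.units_eq_one_or u with rfl | rfl <;> simp
  simp [this]

end Empirical

/-! ### Almost sure counting and bounds for the partition function -/

namespace IsWordGREM

variable {n : ℕ} {S : Finset (List (Fin n))} {k : ℕ → Fin n → ℕ} {p : Fin n → ℝ}
  {lam : S → Measure ℝ} {Ω : Type*} [MeasurableSpace Ω] {P : Measure Ω}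
  {ξ : (N : ℕ) → (s : S) → WordConfig (k N) s → Ω → ℝ}

lemma sum_p (H : IsWordGREM S k p lam P ξ) : ∑ i, p i = 1 := by
  refine tendsto_nhds_unique (tendsto_finsetSum Finset.univ fun i _ => H.lim i) ?_
  refine tendsto_const_nhds.congr' ?_
  filter_upwards [eventually_ge_atTop (max n 1)] with N hN
  have hN0 : (N : ℝ) ≠ 0 := by
    have : 1 ≤ N := (le_max_right _ _).trans hN
    positivity
  rw [← Finset.sum_div, ← Nat.cast_sum, H.sum_eq N ((le_max_left _ _).trans hN), div_self hN0]

lemma sum_p_log (H : IsWordGREM S k p lam P ξ) : ∑ i, p i * Real.log 2 = Real.log 2 := by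
  rw [← Finset.sum_mul, H.sum_p, one_mul]

/-- The infimum in the variational formula is finite. -/
lemma exists_real_eq_iInf (H : IsWordGREM S k p lam P ξ) {f : (S → ℝ) → ℝ} (hf : Continuous f)
    (β h : ℝ) : ∃ m : ℝ, (⨅ z ∈ rateDomain S lam p,
      ((energy f β h z : EReal) + rate S lam p z)) = m := by
  obtain ⟨R, hR⟩ := exists_bound_rateDomain H.prob H.exp H.pos
  obtain ⟨b, hb⟩ := ((isCompact_closedBall (0 : (S → ℝ) × (Fin n → ℝ)) R).image
    (continuous_energy hf β h)).bddBelow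
  obtain ⟨hmem, hzero⟩ := mean_mem_rateDomain H.prob H.exp H.pos
  have hle : (b : EReal) ≤ ⨅ z ∈ rateDomain S lam p,
      ((energy f β h z : EReal) + rate S lam p z) := by
    refine le_iInf₂ fun z hz => ?_
    obtain ⟨a, ha, habs, hrate, -⟩ := exists_real_of_mem_rateDomain H.prob H.pos hz
    have hnn : (0 : EReal) ≤ rate S lam p z := by
      rw [hrate]
      refine EReal.coe_nonneg.2 (add_nonneg (Finset.sum_nonneg fun s _ => ?_)
        (Finset.sum_nonneg fun i _ => mul_nonneg (H.pos i).le (spinEntropy_nonneg (habs i))))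
      have := H.prob s
      exact_mod_cast (cramerRate_nonneg (lam s) (z.1 s)).trans_eq (ha s)
    have hbz : b ≤ energy f β h z :=
      hb ⟨z, by rw [mem_closedBall_zero_iff]; exact hR z hz, rfl⟩
    exact (EReal.coe_le_coe_iff.2 hbz).trans (le_add_of_nonneg_right hnn)
  have hge := iInf₂_le (f := fun z (_ : z ∈ rateDomain S lam p) =>
    ((energy f β h z : EReal) + rate S lam p z)) _ hmem
  rw [hzero, add_zero] at hge
  exact ⟨_, (EReal.coe_toReal (ne_of_lt (hge.trans_lt (EReal.coe_lt_top _)))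
    (ne_of_gt ((EReal.bot_lt_coe b).trans_le hle))).symm⟩

variable [IsProbabilityMeasure P]

/-- Outside the domain, eventually no configuration is seen. -/
lemma eventually_notMem_of_notMem_rateDomain (H : IsWordGREM S k p lam P ξ)
    {z : (S → ℝ) × (Fin n → ℝ)} (hz : z ∉ rateDomain S lam p) :
    ∃ U ∈ 𝓝 z, ∀ᵐ ω ∂P, ∀ᶠ N in atTop, ∀ σ : Config (k N),
      empirical N (fun s τ => ξ N s τ ω) σ ∉ U := by
  simp only [rateDomain, Set.mem_ofPred_eq, not_forall, not_le] at hz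
  obtain ⟨A, hA⟩ := hz
  obtain ⟨c, hc1, hc2⟩ := EReal.lt_iff_exists_real_btwn.1 hA
  rw [EReal.coe_lt_coe_iff] at hc1
  obtain ⟨ε, hε, hε0⟩ := ((eventually_partial_mean_le H.prob H.pos H.lim hc2).and
    self_mem_nhdsWithin).exists
  have hε0 : 0 < ε := hε0
  refine ⟨Metric.ball z ε, Metric.ball_mem_nhds z hε0, ?_⟩
  have hBC := ae_eventually_notMem_of_exp (P := P) (C := 1)
    (η := c - ∑ i ∈ A, p i * Real.log 2) (sub_pos.2 hc1)
    (E := fun N => {ω | ∃ σ : Config (k N), (∀ i, σ i ∈ blockWindow (k N i) N (z.2 i) ε) ∧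
      ∀ s : S, ξ N s (σ.word s) ω ∈ Metric.ball (z.1 s) ε}) ?_
  · filter_upwards [hBC] with ω hω
    filter_upwards [hω] with N hN σ hσ
    exact hN ⟨σ, mem_goodConfigs.1 ((mem_goodConfigs_iff hε0).2 hσ)⟩
  · filter_upwards [hε, eventually_ge_atTop n] with N hN hn
    refine (prob_exists_config_le (H.law N hn) (H.indep N hn) (fun s => measurableSet_ball)
      (fun i => blockWindow (k N i) N (z.2 i) ε) A).trans (hN.trans (le_of_eq ?_))
    rw [one_mul]; congr 1; ring

/-- Near a point of finite rate, the number of configurations is eventually bounded by the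
expected exponential rate. -/
lemma eventually_card_le (H : IsWordGREM S k p lam P ξ) {z : (S → ℝ) × (Fin n → ℝ)} {J : ℝ}
    (hJ : rateSum S lam p Finset.univ z = J) {δ : ℝ} (hδ : 0 < δ) :
    ∃ ε > 0, ∀ᵐ ω ∂P, ∀ᶠ N in atTop,
      ((goodConfigs (fun s τ => ξ N s τ ω) (fun i => blockWindow (k N i) N (z.2 i) ε)
        (fun s => Metric.ball (z.1 s) ε)).card : ℝ) ≤ Real.exp (N * (Real.log 2 - J + δ)) := by
  -- Half of `δ` is lost in bounding the mean; the other half is the exponential gain in Markov's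
  -- inequality.
  have hc : ((J - δ / 2 : ℝ) : EReal) < rateSum S lam p Finset.univ z := by
    rw [hJ, EReal.coe_lt_coe_iff]; linarith
  obtain ⟨ε, hε, hε0⟩ := ((eventually_partial_mean_le H.prob H.pos H.lim hc).and
    self_mem_nhdsWithin).exists
  refine ⟨ε, hε0, ?_⟩
  have hBC := ae_eventually_notMem_of_exp (P := P) (C := 1) (half_pos hδ)
    (E := fun N => {ω | Real.exp (N * (Real.log 2 - J + δ)) ≤
      ((goodConfigs (fun s τ => ξ N s τ ω) (fun i => blockWindow (k N i) N (z.2 i) ε)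
        (fun s => Metric.ball (z.1 s) ε)).card : ℝ)}) ?_
  · filter_upwards [hBC] with ω hω
    filter_upwards [hω] with N hN
    exact (not_le.1 hN).le
  · filter_upwards [hε, eventually_ge_atTop n] with N hN hn
    refine (prob_le_card_goodConfigs (H.law N hn) (H.indep N hn) (fun s => measurableSet_ball)
      (fun i => blockWindow (k N i) N (z.2 i) ε) (Real.exp_pos _)).trans ?_
    rw [wordsIn_univ, H.sum_p_log] at hN
    rw [div_le_iff₀ (Real.exp_pos _), one_mul, ← Real.exp_add]
    refine hN.trans (le_of_eq ?_)
    congr 1; ring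

/-- Where the expected numbers of partial configurations are all exponentially large, the number
of configurations is eventually at least half its mean. -/
lemma eventually_le_card (H : IsWordGREM S k p lam P ξ) {z : (S → ℝ) × (Fin n → ℝ)} {ε η : ℝ}
    (hη : 0 < η) {c : S → ℝ} {d : Fin n → ℝ}
    (hc : ∀ s, ∀ᶠ N : ℕ in atTop, Real.exp (-(N * c s)) ≤
      (sampleMeanLaw (lam s) N).real (Metric.ball (z.1 s) ε))
    (hd : ∀ i, ∀ᶠ N : ℕ in atTop, Real.exp (N * (p i * Real.log 2 - d i)) ≤
      ((blockWindow (k N i) N (z.2 i) ε).card : ℝ))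
    (hstrict : ∀ A : Finset (Fin n), A ≠ ∅ →
      ∑ s ∈ wordsIn S A, c s + ∑ i ∈ A, d i + η ≤ ∑ i ∈ A, p i * Real.log 2) :
    ∀ᵐ ω ∂P, ∀ᶠ N : ℕ in atTop,
      Real.exp (N * (Real.log 2 - (∑ s, c s + ∑ i, d i))) / 2 ≤
      ((goodConfigs (fun s τ => ξ N s τ ω) (fun i => blockWindow (k N i) N (z.2 i) ε)
        (fun s => Metric.ball (z.1 s) ε)).card : ℝ) := by
  -- For non-empty `A` this and `hstrict` make each inverse in the second moment bound at most `exp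
  -- (-(N η))`; for all the blocks it bounds the mean from below.
  have hpart : ∀ᶠ N : ℕ in atTop, ∀ A : Finset (Fin n),
      Real.exp (N * (∑ i ∈ A, p i * Real.log 2 - (∑ s ∈ wordsIn S A, c s + ∑ i ∈ A, d i))) ≤
        (∏ i ∈ A, ((blockWindow (k N i) N (z.2 i) ε).card : ℝ)) *
          ∏ s ∈ wordsIn S A, (sampleMeanLaw (lam s) N).real (Metric.ball (z.1 s) ε) := by
    filter_upwards [eventually_all.2 hc, eventually_all.2 hd] with N h1 h2 A
    refine le_trans (le_of_eq ?_) (mul_le_mul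
      (Finset.prod_le_prod (fun i _ => (Real.exp_pos _).le) fun i _ => h2 i)
      (Finset.prod_le_prod (fun s _ => (Real.exp_pos _).le) fun s _ => h1 s)
      (Finset.prod_nonneg fun s _ => (Real.exp_pos _).le)
      (Finset.prod_nonneg fun i _ => Nat.cast_nonneg _))
    rw [← Real.exp_sum, ← Real.exp_sum, ← Real.exp_add]
    congr 1
    rw [Finset.sum_neg_distrib, ← Finset.mul_sum, ← Finset.mul_sum, Finset.sum_sub_distrib]
    ring
  have hBC := ae_eventually_notMem_of_exp (P := P)
    (C := 4 * (Finset.univ.erase (∅ : Finset (Fin n))).card) hη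
    (E := fun N => {ω | ((goodConfigs (fun s τ => ξ N s τ ω)
      (fun i => blockWindow (k N i) N (z.2 i) ε) (fun s => Metric.ball (z.1 s) ε)).card : ℝ) <
        ((∏ i, ((blockWindow (k N i) N (z.2 i) ε).card : ℝ)) *
          ∏ s, (sampleMeanLaw (lam s) N).real (Metric.ball (z.1 s) ε)) / 2}) ?_
  · filter_upwards [hBC] with ω hω
    filter_upwards [hω, hpart] with N hN hN2
    have h3 := hN2 Finset.univ
    rw [wordsIn_univ, H.sum_p_log] at h3
    have h4 := not_lt.1 hN
    linarith
  · filter_upwards [eventually_all.2 hc, eventually_all.2 hd, hpart, eventually_ge_atTop n]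
      with N h1 h2 h3 hn
    refine (prob_card_goodConfigs_lt H.ne_nil (H.law N hn) (H.indep N hn)
      (fun s => measurableSet_ball) (fun i => blockWindow (k N i) N (z.2 i) ε)
      (fun i => (Real.exp_pos _).trans_le (h2 i)) fun s => (Real.exp_pos _).trans_le (h1 s)).trans ?_
    rw [mul_assoc, ← nsmul_eq_mul, ← Finset.sum_const]
    refine mul_le_mul_of_nonneg_left (Finset.sum_le_sum fun A hA => ?_) (by norm_num)
    rw [Real.exp_neg]
    refine inv_anti₀ (Real.exp_pos _) (le_trans ?_ (h3 A))
    rw [Real.exp_le_exp]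
    have := hstrict A (Finset.ne_of_mem_erase hA)
    gcongr
    linarith

/-- Exponential tightness: eventually all configurations see a fixed compact set. -/
lemma exists_eventually_norm_le (H : IsWordGREM S k p lam P ξ) :
    ∃ R : ℝ, ∀ᵐ ω ∂P, ∀ᶠ N in atTop, ∀ σ : Config (k N),
      empirical N (fun s τ => ξ N s τ ω) σ ∈ Metric.closedBall 0 R := by
  choose r hr C _ hC using fun s =>
    have := H.prob s
    exists_linear_tail (H.exp s)
  -- With this level the tail exponent is `-(log 2 + 1)`: a union bound over the `2 ^ N`
  -- configurations still leaves `2 exp (-N)`.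
  set L : S → ℝ := fun s => (C s + Real.log 2 + 1) / r s with hL
  have hrL : ∀ s, r s * L s = C s + Real.log 2 + 1 := fun s => mul_div_cancel₀ _ (hr s).ne'
  obtain ⟨R, hR⟩ := (Set.finite_range L).bddAbove
  have hBC : ∀ s, ∀ᵐ ω ∂P, ∀ᶠ N in atTop,
      ω ∉ {ω | ∃ σ : Config (k N), L s ≤ |ξ N s (σ.word s) ω|} := by
    intro s
    refine ae_eventually_notMem_of_exp (C := 2) one_pos ?_
    filter_upwards [eventually_ge_atTop n] with N hn
    have hN1 : 1 ≤ N := H.one_le.trans hn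
    have hset : {ω | ∃ σ : Config (k N), L s ≤ |ξ N s (σ.word s) ω|} =
        ⋃ σ ∈ (Finset.univ : Finset (Config (k N))), {ω | L s ≤ |ξ N s (σ.word s) ω|} := by
      ext ω; simp
    rw [hset]
    refine (measureReal_biUnion_finset_le _ _).trans ?_
    have hone : ∀ σ : Config (k N), P.real {ω | L s ≤ |ξ N s (σ.word s) ω|} ≤
        2 * Real.exp (N * (C s - r s * L s)) := by
      intro σ
      have := (H.law N hn s (σ.word s)).measureReal_eq (p := fun u => L s ≤ |u|)
        (measurableSet_le (by fun_prop) (by fun_prop))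
      rw [this]
      exact hC s (L s) N hN1
    refine (Finset.sum_le_sum fun σ _ => hone σ).trans (le_of_eq ?_)
    rw [Finset.sum_const, Finset.card_univ, card_config, H.sum_eq N hn, nsmul_eq_mul, hrL]
    push_cast
    nth_rw 1 [← Real.exp_log two_pos]
    rw [← Real.exp_nat_mul, mul_left_comm, ← Real.exp_add]
    congr 2; ring
  refine ⟨max 1 R, ?_⟩
  filter_upwards [ae_all_iff.2 hBC] with ω hω
  filter_upwards [eventually_all.2 hω, eventually_ge_atTop n] with N hN hn σ
  have hN0 : (0 : ℝ) < N := by exact_mod_cast H.one_le.trans hn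
  have hR0 : (0 : ℝ) ≤ max 1 R := zero_le_one.trans (le_max_left _ _)
  rw [mem_closedBall_zero_iff, Prod.norm_def, max_le_iff, pi_norm_le_iff_of_nonneg hR0,
    pi_norm_le_iff_of_nonneg hR0]
  refine ⟨fun s => ?_, fun i => ?_⟩
  · refine le_trans ?_ ((hR ⟨s, rfl⟩).trans (le_max_right _ _))
    by_contra! hcon
    exact hN s ⟨σ, hcon.le⟩
  · refine le_trans ?_ (le_max_left _ _)
    simp only [empirical]
    rw [Real.norm_eq_abs, abs_div, abs_of_pos hN0, div_le_one hN0]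
    refine (abs_blockSum_le σ i).trans ?_
    have : k N i ≤ ∑ i, k N i := Finset.single_le_sum (fun _ _ => Nat.zero_le _) (Finset.mem_univ i)
    rw [H.sum_eq N hn] at this
    exact_mod_cast this

open Classical in
/-- The upper bound for the partition function. -/
lemma eventually_partitionFunction_le (H : IsWordGREM S k p lam P ξ) {f : (S → ℝ) → ℝ}
    (hf : Continuous f) (β h : ℝ) {F : ℝ}
    (hF : ∀ z ∈ rateDomain S lam p, ((Real.log 2 - F : ℝ) : EReal) ≤
      (energy f β h z : EReal) + rate S lam p z) {δ : ℝ} (hδ : 0 < δ) :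
    ∃ C : ℝ, ∀ᵐ ω ∂P, ∀ᶠ N : ℕ in atTop,
      partitionFunction S f β h N (fun s τ => ξ N s τ ω) ≤ C * Real.exp (N * (F + δ)) := by
  obtain ⟨R, hR⟩ := H.exists_eventually_norm_le
  have hcov : ∃ C : ℝ, ∀ᵐ ω ∂P, ∀ᶠ N : ℕ in atTop,
      ∑ σ : Config (k N) with empirical N (fun s τ => ξ N s τ ω) σ ∈
        Metric.closedBall (0 : (S → ℝ) × (Fin n → ℝ)) R,
        Real.exp (-(N * energy f β h (empirical N (fun s τ => ξ N s τ ω) σ))) ≤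
          C * Real.exp (N * (F + δ)) := by
    -- The property that the configurations seen in `U` contribute at most a constant times `exp (N
    -- (F + δ))` passes to subsets and finite unions, so it only has to be checked near each point.
    refine (isCompact_closedBall (0 : (S → ℝ) × (Fin n → ℝ)) R).induction_on
      (p := fun U => ∃ C : ℝ, ∀ᵐ ω ∂P, ∀ᶠ N : ℕ in atTop,
        ∑ σ : Config (k N) with empirical N (fun s τ => ξ N s τ ω) σ ∈ U,
          Real.exp (-(N * energy f β h (empirical N (fun s τ => ξ N s τ ω) σ))) ≤
            C * Real.exp (N * (F + δ))) ⟨0, by simp⟩ ?_ ?_ ?_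
    · rintro U V hUV ⟨C, hC⟩
      refine ⟨C, ?_⟩
      filter_upwards [hC] with ω hω
      filter_upwards [hω] with N hN
      refine le_trans (Finset.sum_le_sum_of_subset_of_nonneg ?_
        fun _ _ _ => (Real.exp_pos _).le) hN
      exact Finset.monotone_filter_right _ fun σ _ hσ => hUV hσ
    · rintro U V ⟨C, hC⟩ ⟨D, hD⟩
      refine ⟨C + D, ?_⟩
      filter_upwards [hC, hD] with ω hω hω'
      filter_upwards [hω, hω'] with N hN hN'
      rw [add_mul]
      refine le_trans ?_ (add_le_add hN hN')
      rw [← Finset.sum_union_inter]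
      simp only [Set.mem_union, Finset.filter_or]
      exact le_add_of_nonneg_right (Finset.sum_nonneg fun _ _ => (Real.exp_pos _).le)
    · intro z _
      by_cases hz : z ∈ rateDomain S lam p
      · obtain ⟨a, -, -, hrate, hA⟩ := exists_real_of_mem_rateDomain H.prob H.pos hz
        have hsum := (hA Finset.univ).1
        rw [wordsIn_univ] at hsum
        have hFz := hF z hz
        set J := ∑ s, a s + ∑ i, p i * spinEntropy (z.2 i / p i) with hJ
        rw [hrate, ← EReal.coe_add, EReal.coe_le_coe_iff] at hFz
        obtain ⟨ε, hε, hcard⟩ := H.eventually_card_le hsum (half_pos hδ)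
        -- On `U` the energy is lower by at most `δ / 2`; the count uses the other half of `δ`.
        obtain ⟨U, hU, hUball, hUen⟩ : ∃ U ∈ 𝓝 z, (∀ w ∈ U, w ∈ Metric.ball z ε) ∧
            ∀ w ∈ U, energy f β h z - δ / 2 < energy f β h w :=
          ⟨Metric.ball z ε ∩ {w | energy f β h z - δ / 2 < energy f β h w},
            Filter.inter_mem (Metric.ball_mem_nhds z hε)
              (((continuous_energy hf β h).tendsto z).eventually_const_lt (by linarith)),
            fun w hw => hw.1, fun w hw => hw.2⟩
        refine ⟨U, mem_nhdsWithin_of_mem_nhds hU, 1, ?_⟩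
        filter_upwards [hcard] with ω hω
        filter_upwards [hω] with N hN
        refine (Finset.sum_le_card_nsmul _ _
          (Real.exp (-(N * (energy f β h z - δ / 2)))) ?_).trans ?_
        · intro σ hσ
          have h1 := hUen _ (Finset.mem_filter.1 hσ).2
          rw [Real.exp_le_exp]
          have : energy f β h z - δ / 2 ≤
            energy f β h (empirical N (fun s τ => ξ N s τ ω) σ) := le_of_lt h1
          gcongr
        · rw [nsmul_eq_mul, one_mul]
          refine (mul_le_mul_of_nonneg_right (le_trans (Nat.cast_le.2
            (Finset.card_le_card ?_)) hN) (Real.exp_pos _).le).trans ?_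
          · intro σ hσ
            exact (mem_goodConfigs_iff hε).2 (hUball _ (Finset.mem_filter.1 hσ).2)
          · rw [← Real.exp_add, ← mul_neg, ← mul_add]
            exact Real.exp_le_exp.2
              (mul_le_mul_of_nonneg_left (by linarith) (Nat.cast_nonneg N))
      · obtain ⟨U, hU, hUe⟩ := H.eventually_notMem_of_notMem_rateDomain hz
        refine ⟨U, mem_nhdsWithin_of_mem_nhds hU, 0, ?_⟩
        filter_upwards [hUe] with ω hω
        filter_upwards [hω] with N hN
        rw [Finset.filter_false_of_mem fun σ _ => hN σ]
        simp
  obtain ⟨C, hC⟩ := hcov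
  refine ⟨C, ?_⟩
  filter_upwards [hC, hR] with ω h1 h2
  filter_upwards [h1, h2, eventually_ge_atTop 1] with N h3 h4 hN1
  rw [Finset.filter_true_of_mem fun σ _ => h4 σ] at h3
  rw [partitionFunction_eq_sum f β h hN1]
  exact h3

/-- The lower bound for the partition function. -/
lemma eventually_le_partitionFunction (H : IsWordGREM S k p lam P ξ) {f : (S → ℝ) → ℝ}
    (hf : Continuous f) (β h : ℝ) {z : (S → ℝ) × (Fin n → ℝ)} (hz : z ∈ rateDomain S lam p)
    {F : ℝ} (hF : (energy f β h z : EReal) + rate S lam p z < ((Real.log 2 - F : ℝ) : EReal)) :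
    ∀ᵐ ω ∂P, ∀ᶠ N : ℕ in atTop,
      Real.exp (N * F) / 2 ≤ partitionFunction S f β h N (fun s τ => ξ N s τ ω) := by
  obtain ⟨a, ha, habs, hrate, hA⟩ := exists_real_of_mem_rateDomain H.prob H.pos hz
  set e : Fin n → ℝ := fun i => p i * spinEntropy (z.2 i / p i) with he
  rw [hrate, ← EReal.coe_add, EReal.coe_lt_coe_iff] at hF
  set g := Real.log 2 - F - (energy f β h z + (∑ s, a s + ∑ i, e i)) with hg
  have hg0 : 0 < g := sub_pos.2 hF
  have ha0 : ∀ s, 0 ≤ a s := fun s => by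
    have := H.prob s
    exact_mod_cast (cramerRate_nonneg (lam s) (z.1 s)).trans_eq (ha s)
  have he0 : ∀ i, 0 ≤ e i := fun i =>
    mul_nonneg (H.pos i).le (spinEntropy_nonneg (habs i))
  let m : S → ℝ := fun s => ∫ u, u ∂(lam s)
  -- The segment from the typical point (`t = 0`) to `z` (`t = 1`). The magnetisations are written
  -- `p i * v`, the form of the centres in `eventually_le_card_blockWindow`.
  let zt : ℝ → (S → ℝ) × (Fin n → ℝ) := fun t =>
    (fun s => m s + t * (z.1 s - m s), fun i => p i * (t * (z.2 i / p i)))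
  have hzt : Continuous zt := by fun_prop
  have hzt1 : zt 1 = z := by
    refine Prod.ext (funext fun s => ?_) (funext fun i => ?_)
    · simp [zt]
    · simp only [zt, one_mul]
      exact mul_div_cancel₀ _ (H.pos i).ne'
  have hlim : Tendsto (fun t => energy f β h (zt t)) (𝓝[<] 1) (𝓝 (energy f β h z)) := by
    have := ((continuous_energy (n := n) hf β h).comp hzt).tendsto 1
    simp only [Function.comp_apply, hzt1] at this
    exact this.mono_left nhdsWithin_le_nhds
  obtain ⟨t, ⟨ht, ht1⟩, ht0⟩ := ((hlim.eventually_lt_const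
    (show energy f β h z < energy f β h z + g / 4 by linarith)).and eventually_mem_nhdsWithin).and
      ((eventually_gt_nhds (show (0 : ℝ) < 1 by norm_num)).filter_mono nhdsWithin_le_nhds)
    |>.exists
  have ht1 : t < 1 := ht1
  obtain ⟨ε, hε, hball⟩ := Metric.eventually_nhds_iff_ball.1
    (((continuous_energy (n := n) hf β h).tendsto (zt t)).eventually_lt_const
      (show energy f β h (zt t) < energy f β h (zt t) + g / 4 by linarith))
  -- Shrinking the rates by `t` leaves a slack of `(1 - t) ∑ i ∈ A, p i log 2`, positive for
  -- non-empty `A`; there are finitely many `A`, hence a common `η`.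
  have hη : ∃ η > 0, ∀ A : Finset (Fin n), A ≠ ∅ →
      t * (∑ s ∈ wordsIn S A, a s + ∑ i ∈ A, e i) + η ≤ ∑ i ∈ A, p i * Real.log 2 := by
    have hfin : ∀ᶠ η in 𝓝[>] (0 : ℝ), ∀ A : Finset (Fin n), A ≠ ∅ →
        t * (∑ s ∈ wordsIn S A, a s + ∑ i ∈ A, e i) + η ≤ ∑ i ∈ A, p i * Real.log 2 := by
      refine eventually_all.2 fun A => ?_
      by_cases hAe : A = ∅
      · exact Eventually.of_forall fun _ h => absurd hAe h
      have hpos : 0 < ∑ i ∈ A, p i * Real.log 2 :=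
        Finset.sum_pos (fun i _ => mul_pos (H.pos i) (Real.log_pos one_lt_two))
          (Finset.nonempty_iff_ne_empty.2 hAe)
      have hlt : 0 < (1 - t) * ∑ i ∈ A, p i * Real.log 2 := mul_pos (by linarith) hpos
      filter_upwards [Ioo_mem_nhdsGT hlt] with η hη _
      have := mul_le_mul_of_nonneg_left (hA A).2 ht0.le
      linarith [hη.2]
    obtain ⟨η, h1, h2⟩ := (hfin.and self_mem_nhdsWithin).exists
    exact ⟨η, h2, h1⟩
  obtain ⟨η, hη0, hη⟩ := hη
  -- At most `K` rates are each raised by `κ` to make the bounds strict. In total this costs at most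
  -- half of the slack `η` and a quarter of the gap `g`; moving to `zt t` and the radius `ε` cost
  -- the energy another quarter each.
  set K : ℝ := (S.card : ℝ) + n + 1 with hK
  have hK0 : 0 < K := by positivity
  set κ : ℝ := min (η / 2) (g / 4) / K with hκ
  have hκ0 : 0 < κ := div_pos (lt_min (by linarith) (by linarith)) hK0
  have hκK : κ * K = min (η / 2) (g / 4) := div_mul_cancel₀ _ hK0.ne'
  have hsumκ : ∀ (T : Finset S) (A : Finset (Fin n)),
      ∑ s ∈ T, (t * a s + κ) + ∑ i ∈ A, (t * e i + κ) ≤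
        t * (∑ s ∈ T, a s + ∑ i ∈ A, e i) + min (η / 2) (g / 4) := by
    intro T A
    rw [Finset.sum_add_distrib, Finset.sum_add_distrib, ← Finset.mul_sum, ← Finset.mul_sum,
      Finset.sum_const, Finset.sum_const, nsmul_eq_mul, nsmul_eq_mul, ← hκK]
    have h1 : (T.card : ℝ) ≤ S.card := by
      have := T.card_le_univ
      rw [Fintype.card_coe] at this
      exact_mod_cast this
    have h2 : (A.card : ℝ) ≤ n := by
      have := A.card_le_univ
      rw [Fintype.card_fin] at this
      exact_mod_cast this
    nlinarith
  have hmain := H.eventually_le_card (z := zt t) (ε := ε) (η := η / 2) (half_pos hη0)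
    (c := fun s => t * a s + κ) (d := fun i => t * e i + κ) ?_ ?_ ?_
  · filter_upwards [hmain] with ω hω
    filter_upwards [hω, eventually_ge_atTop 1] with N hN hN1
    rw [partitionFunction_eq_sum f β h hN1]
    refine le_trans ?_ (Finset.sum_le_sum_of_subset_of_nonneg (Finset.subset_univ
      (goodConfigs (fun s τ => ξ N s τ ω) (fun i => blockWindow (k N i) N ((zt t).2 i) ε)
        (fun s => Metric.ball ((zt t).1 s) ε))) fun _ _ _ => (Real.exp_pos _).le)
    refine le_trans ?_ (Finset.card_nsmul_le_sum _ _
      (Real.exp (-(N * (energy f β h z + g / 2)))) ?_)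
    · rw [nsmul_eq_mul]
      refine le_trans ?_ (mul_le_mul_of_nonneg_right hN (Real.exp_pos _).le)
      rw [div_mul_eq_mul_div, ← Real.exp_add, ← mul_neg, ← mul_add]
      have h1 := hsumκ Finset.univ Finset.univ
      have h2 : min (η / 2) (g / 4) ≤ g / 4 := min_le_right _ _
      have h3 : t * (∑ s, a s + ∑ i, e i) ≤ ∑ s, a s + ∑ i, e i :=
        mul_le_of_le_one_left (add_nonneg (Finset.sum_nonneg fun s _ => ha0 s)
          (Finset.sum_nonneg fun i _ => he0 i)) ht1.le
      refine div_le_div_of_nonneg_right (Real.exp_le_exp.2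
        (mul_le_mul_of_nonneg_left ?_ (Nat.cast_nonneg N))) two_pos.le
      linarith
    · intro σ hσ
      rw [Real.exp_le_exp]
      have := hball _ ((mem_goodConfigs_iff hε).1 hσ)
      gcongr
      linarith
  · intro s
    have := H.prob s
    exact eventually_exp_le_sampleMeanLaw_segment (H.exp s) (ha s).le ht0.le ht1
      (by linarith) hε
  · intro i
    have habs' : |t * (z.2 i / p i)| < 1 := by
      rw [abs_mul, abs_of_pos ht0]
      nlinarith [habs i, abs_nonneg (z.2 i / p i)]
    refine eventually_le_card_blockWindow (k := fun N => k N i) (H.pos i) (H.lim i) habs' ?_ hε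
    have := mul_le_mul_of_nonneg_left (spinEntropy_mul_le (habs i) ht0.le ht1.le) (H.pos i).le
    have h2 : p i * (t * spinEntropy (z.2 i / p i)) = t * e i := by rw [he]; ring
    linarith
  · intro A hAe
    have h1 := hsumκ (wordsIn S A) A
    have h2 : min (η / 2) (g / 4) ≤ η / 2 := min_le_left _ _
    linarith [hη A hAe]

end IsWordGREM

/-! ### From exponential bounds to the limit -/

/-- Convergence of the exponential rate from two-sided exponential bounds. -/
lemma ae_tendsto_log_div_of_exp_bounds {Ω : Type*} [MeasurableSpace Ω] {P : Measure Ω}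
    {Z : ℕ → Ω → ℝ} {F : ℝ}
    (hup : ∀ δ > 0, ∃ C : ℝ, ∀ᵐ ω ∂P, ∀ᶠ N : ℕ in atTop, Z N ω ≤ C * Real.exp (N * (F + δ)))
    (hlo : ∀ δ > 0, ∀ᵐ ω ∂P, ∀ᶠ N : ℕ in atTop, Real.exp (N * (F - δ)) / 2 ≤ Z N ω) :
    ∀ᵐ ω ∂P, Tendsto (fun N : ℕ => (1 / (N : ℝ)) * Real.log (Z N ω)) atTop (𝓝 F) := by
  -- The exceptional null sets depend on `δ`, so only the countably many values `1 / (m + 1)` are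
  -- used.
  have hpos : ∀ m : ℕ, (0 : ℝ) < 1 / ((m : ℝ) + 1) := fun m => by positivity
  choose C hC using fun m : ℕ => hup _ (hpos m)
  have hlo' := fun m : ℕ => hlo _ (hpos m)
  filter_upwards [ae_all_iff.2 hC, ae_all_iff.2 hlo'] with ω h1 h2
  refine Metric.tendsto_nhds.2 fun δ hδ => ?_
  obtain ⟨m, hm⟩ := exists_nat_one_div_lt (half_pos hδ)
  -- Nothing makes `C m` positive, and its logarithm is needed.
  set D := max (C m) 1 with hD
  have hD0 : 0 < D := lt_max_of_lt_right one_pos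
  have t1 := tendsto_const_div_atTop_nhds_zero_nat (Real.log D)
  have t2 := tendsto_const_div_atTop_nhds_zero_nat (Real.log 2)
  filter_upwards [h1 m, h2 m, t1.eventually_lt_const (half_pos hδ),
    t2.eventually_lt_const (half_pos hδ), eventually_ge_atTop 1] with N hu hl hD' h2' hN
  have hN0 : (0 : ℝ) < N := by exact_mod_cast hN
  have hZ : 0 < Z N ω := lt_of_lt_of_le (by positivity) hl
  have hu' : Real.log (Z N ω) ≤ Real.log D + N * (F + 1 / ((m : ℝ) + 1)) := by
    rw [← Real.log_exp (N * (F + 1 / ((m : ℝ) + 1))), ← Real.log_mul hD0.ne'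
      (Real.exp_pos _).ne']
    refine Real.log_le_log hZ (hu.trans ?_)
    exact mul_le_mul_of_nonneg_right (le_max_left _ _) (Real.exp_pos _).le
  have hl' : N * (F - 1 / ((m : ℝ) + 1)) - Real.log 2 ≤ Real.log (Z N ω) := by
    rw [← Real.log_exp (N * (F - 1 / ((m : ℝ) + 1))), ← Real.log_div (Real.exp_pos _).ne'
      two_ne_zero]
    exact Real.log_le_log (by positivity) hl
  rw [Real.dist_eq, one_div_mul_eq_div, abs_lt]
  rw [div_lt_iff₀ hN0] at hD' h2'
  constructor
  · rw [lt_sub_iff_add_lt, lt_div_iff₀ hN0]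
    nlinarith
  · rw [sub_lt_iff_lt_add, div_lt_iff₀ hN0]
    nlinarith

end WordGREM

theorem mainTheorem10
    {n : ℕ} (hn : 1 ≤ n)
    (S : Finset (List (Fin n))) (hS : ∀ s ∈ S, s ≠ [])
    (k : ℕ → Fin n → ℕ) (p : Fin n → ℝ)
    (hk_pos : ∀ N, n ≤ N → ∀ i, 1 ≤ k N i)
    (hk_sum : ∀ N, n ≤ N → ∑ i, k N i = N)
    (hk_lim : ∀ i, Tendsto (fun N : ℕ => (k N i : ℝ) / (N : ℝ)) atTop (𝓝 (p i)))
    (hp : ∀ i, 0 < p i)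
    (lam : S → Measure ℝ) (hlam_prob : ∀ s, IsProbabilityMeasure (lam s))
    (hlam_exp : ∀ s, (0 : ℝ) ∈ interior (integrableExpSet id (lam s)))
    (f : (S → ℝ) → ℝ) (hf : Continuous f)
    (β h : ℝ) (hβ : 0 < β) (hh : 0 ≤ h)
    {Ω : Type*} [MeasurableSpace Ω] (P : Measure Ω) [IsProbabilityMeasure P]
    (ξ : (N : ℕ) → (s : S) → WordGREM.WordConfig (k N) s → Ω → ℝ)
    (hξ_law : ∀ N, n ≤ N → ∀ (s : S) (τ : WordGREM.WordConfig (k N) s),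
      HasLaw (ξ N s τ) (WordGREM.sampleMeanLaw (lam s) N) P)
    (hξ_indep : ∀ N, n ≤ N →
      iIndepFun (fun a : (s : S) × WordGREM.WordConfig (k N) s => ξ N a.1 a.2) P) :
    ∃ F : ℝ,
      (F : EReal) = (Real.log 2 : EReal) -
        (⨅ z ∈ WordGREM.rateDomain S lam p,
          (((β * f z.1 + β * h * ∑ i, z.2 i : ℝ) : EReal) + WordGREM.rate S lam p z)) ∧
      ∀ᵐ ω ∂P, Tendsto
        (fun N : ℕ => (1 / (N : ℝ)) *
          Real.log (WordGREM.partitionFunction S f β h N (fun s τ => ξ N s τ ω)))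
        atTop (𝓝 F) := by
  have H : WordGREM.IsWordGREM S k p lam P ξ :=
    ⟨hn, hS, hk_sum, hk_lim, hp, hlam_prob, hlam_exp, hξ_law, hξ_indep⟩
  obtain ⟨m, hm⟩ := H.exists_real_eq_iInf hf β h
  have hm' := hm
  simp only [WordGREM.energy] at hm'
  refine ⟨Real.log 2 - m, by rw [hm', EReal.coe_sub], ?_⟩
  refine WordGREM.ae_tendsto_log_div_of_exp_bounds (fun δ hδ => ?_) fun δ hδ => ?_
  · refine H.eventually_partitionFunction_le hf β h (fun z hz => ?_) hδ
    rw [sub_sub_cancel, ← hm]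
    exact iInf₂_le (f := fun z (_ : z ∈ WordGREM.rateDomain S lam p) =>
      ((WordGREM.energy f β h z : EReal) + WordGREM.rate S lam p z)) z hz
  · have hlt : (⨅ z ∈ WordGREM.rateDomain S lam p,
        ((WordGREM.energy f β h z : EReal) + WordGREM.rate S lam p z)) < ((m + δ : ℝ) : EReal) := by
      rw [hm, EReal.coe_lt_coe_iff]; linarith
    simp only [iInf_lt_iff] at hlt
    obtain ⟨z, hz, hzlt⟩ := hlt
    refine H.eventually_le_partitionFunction hf β h hz ?_
    rwa [show Real.log 2 - (Real.log 2 - m - δ) = m + δ by ring]
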